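/- Let $n>3$. The Hopf map $\mathbb{H}\to\mathbb{R}^3$ is $\operatorname{Hopf}(q)=\bar q\,\mathbf{i}\,q$, where the imaginary quaternions are identified with $\mathbb{R}^3$. The Hopf-Gaussian measure on the space $\mathscr{A}_3(n)=(\mathbb{R}^3)^n$ of $n$-edge arms $(\vec e_1,\dots,\vec e_n)$ is the pushforward of the standard Gaussian measure on $\mathbb{H}^n=\mathbb{R}^{4n}$ by the coordinatewise Hopf map. The Hopf-Gaussian measure on the space $\mathscr{P}_3(n)=\{\sum_i \vec e_i=\vec 0\}\subset\mathscr{A}_3(n)$ of closed polygons is the corresponding probability measure conditioned on closure, i.e. the weak limit, as $\varepsilon\to0^+$, of the Hopf-Gaussian measure on $\mathscr{A}_3(n)$ conditioned on $|\sum_i\vec e_i|<\varepsilon$; this limit exists and is unique. Let $\vec e_1,\vec e_2$ be two (cyclically) consecutive edges of a random closed polygon distributed according to the Hopf-Gaussian measure on $\mathscr{P}_3(n)$. Then the joint distribution of $(\vec e_1,\vec e_2)$ on $\mathbb{R}^3\times\mathbb{R}^3$ is invariant under the diagonal action of $SO(3)$ and under rotations which fix one of the two edges (also when the rotation depends measurably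 on the fixed edge). It has a density with respect to $\operatorname{dVol}_{\vec e_1}\operatorname{dVol}_{\vec e_2}$ which depends only on the lengths $r_1=|\vec e_1|$, $r_2=|\vec e_2|$ and the angle $\theta\in[0,\pi]$ between $\vec e_1$ and $\vec e_2$. The joint density of $(r_1,r_2,\theta)$ with respect to $\mathrm{d}r_1\,\mathrm{d}r_2\,\mathrm{d}\theta$ on $(0,\infty)\times(0,\infty)\times(0,\pi)$ is $$P(r_1,r_2,\theta)=\frac{\Gamma(n)}{4\sqrt{\pi}\,\Gamma(2n-4)}\,r_1r_2\,e^{-\frac12(r_1+r_2)}\,z^{n-\frac72}\,K_{n-\frac72}\!\left(\frac z2\right)\sin\theta,$$ where $z=|\vec e_1+\vec e_2|=\sqrt{r_1^2+r_2^2+2r_1r_2\cos\theta}$ and $K_\nu(u)=\int_0^\infty e^{-u\cosh t}\cosh(\nu t)\,\mathrm{d}t$ $(u>0)$ is the modified Bessel function of the second kind. Moreover, the joint density of $x=(r_1+r_2)/2$, $y=(r_1-r_2)/2$ and $z=|\vec e_1+\vec e_2|$ with respect to $\mathrm{d}x\,\mathrm{d}y\,\mathrm{d}z$ on the region $\{z>0,\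 x>z/2,\ |y|<z/2\}$ (and zero outside it) is $$P(x,y,z)=\frac{\Gamma(n)}{2\sqrt{\pi}\,\Gamma(2n-4)}\,e^{-x}\,z^{n-\frac52}\,K_{n-\frac72}\!\left(\frac z2\right).$$ -/

import Mathlib

open MeasureTheory ProbabilityTheory Filter Topology Set
open scoped ENNReal Quaternion BoundedContinuousFunction

noncomputable section

namespace HopfPolygon

/-- Euclidean 3-space. -/
abbrev E3 : Type := EuclideanSpace ℝ (Fin 3)

/-- The space of `n`-edge arms in `ℝ³` up to translation: lists of `n` edge vectors. -/
abbrev Arm (n : ℕ) : Type := Fin n → E3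

/-- The space of closed `n`-gons in `ℝ³` up to translation: arms whose edges sum to zero. -/
def closedPolygons (n : ℕ) : Set (Arm n) := {e | ∑ i, e i = 0}

/-- The quaternion with coordinates `q 0 + q 1 𝐢 + q 2 𝐣 + q 3 𝐤`. -/
def quat (q : Fin 4 → ℝ) : ℍ[ℝ] := (Quaternion.equivTuple ℝ).symm q

/-- The Hopf map `q ↦ q̄ 𝐢 q`, with imaginary quaternions identified with `ℝ³`. -/
def hopf (q : ℍ[ℝ]) : E3 :=
  let w : ℍ[ℝ] := star q * quat ![0, 1, 0, 0] * q
  !₂[w.imI, w.imJ, w.imK]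

/-- The standard Gaussian measure on `ℍⁿ = ℝ⁴ⁿ`, in coordinates: all `4n` real coordinates are
independent standard normals. -/
def gaussianHn (n : ℕ) : Measure (Fin n → Fin 4 → ℝ) :=
  Measure.pi fun _ => Measure.pi fun _ => gaussianReal 0 1

/-- The Hopf-Gaussian measure on arm space: the pushforward of the standard Gaussian measure on
`ℍⁿ` by the coordinatewise Hopf map. -/
def hopfGaussianArm (n : ℕ) : Measure (Arm n) :=
  (gaussianHn n).map fun q i => hopf (quat (q i))

/-- `μ` is the Hopf-Gaussian probability measure on closed `n`-gons, that is, the subspace measure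
inherited from arm space: the law of a Hopf-Gaussian arm conditioned on closure. As closure is a
null event, this is the weak limit, as `ε → 0⁺`, of the Hopf-Gaussian measure conditioned on the
tube `‖e₁ + ⋯ + eₙ‖ < ε` around the linear subspace of closed polygons (up to the factor `√n` in
`ε`, these tubes are the metric neighbourhoods of the subspace in `ℝ³ⁿ`). -/
def IsHopfGaussianPolygonMeasure (n : ℕ) (μ : Measure (closedPolygons n)) : Prop :=
  IsProbabilityMeasure μ ∧
    ∀ f : Arm n →ᵇ ℝ,
      Tendsto (fun ε : ℝ => ∫ e, f e ∂(cond (hopfGaussianArm n) {e : Arm n | ‖∑ i, e i‖ < ε}))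
        (𝓝[>] 0) (𝓝 (∫ p : closedPolygons n, f p ∂μ))

/-- The joint law of the consecutive edges `eᵢ, eᵢ₊₁` (indices cyclic) of a closed polygon with
law `μ`. -/
def edgePairLaw {n : ℕ} (μ : Measure (closedPolygons n)) (i : Fin n) : Measure (E3 × E3) :=
  μ.map fun p => (p.1 i, p.1 (finRotate n i))

/-- The rotation group of `ℝ³`. -/
abbrev SO3 : Type := Matrix.specialOrthogonalGroup (Fin 3) ℝ

/-- The action of rotations on `ℝ³`. -/
def rot (A : SO3) (v : E3) : E3 := WithLp.toLp 2 (A.1.mulVec v.ofLp)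

/-- The modified Bessel function of the second kind `K_ν(z)`, for `z > 0`. -/
def besselK (ν z : ℝ) : ℝ := ∫ t in Ioi (0 : ℝ), Real.exp (-z * Real.cosh t) * Real.cosh (ν * t)

/-- The length of the sum of two vectors of lengths `r₁, r₂` at angle `θ`. -/
def chord (r₁ r₂ θ : ℝ) : ℝ := Real.sqrt (r₁ ^ 2 + r₂ ^ 2 + 2 * r₁ * r₂ * Real.cos θ)

/-- The density `P(r₁, r₂, θ)`. -/
def pairDensity (n : ℕ) (r₁ r₂ θ : ℝ) : ℝ :=
  Real.Gamma n / (4 * Real.sqrt Real.pi * Real.Gamma (2 * (n : ℝ) - 4)) * (r₁ * r₂)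
    * Real.exp (-(1 / 2) * (r₁ + r₂)) * chord r₁ r₂ θ ^ ((n : ℝ) - 7 / 2)
    * besselK ((n : ℝ) - 7 / 2) (chord r₁ r₂ θ / 2) * Real.sin θ

/-- The density `P(x, y, z)`. -/
def pairDensityXYZ (n : ℕ) (x _y z : ℝ) : ℝ :=
  Real.Gamma n / (2 * Real.sqrt Real.pi * Real.Gamma (2 * (n : ℝ) - 4))
    * Real.exp (-x) * z ^ ((n : ℝ) - 5 / 2) * besselK ((n : ℝ) - 7 / 2) (z / 2)

end HopfPolygon

end

/-!
The Hopf image of a standard Gaussian quaternion has characteristic function `(1 + 4‖t‖²)⁻¹`: it is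
a Gaussian vector whose variance is exponentially distributed. Sums of `m` edges are therefore
Gaussian vectors with gamma distributed variance, and their densities are Bessel functions of the
norm. Conditioning on closure multiplies the density of the pair `(e₁, e₂)` by the density of the
sum of the other `n - 2` edges at `-(e₁ + e₂)`, divided by the density of the sum of all edges at
`0`. The result depends on `|e₁|`, `|e₂|` and their angle only, so spherical coordinates and the
change of variables `θ ↦ |e₁ + e₂|` give the two explicit densities.
-/

noncomputable section

namespace HopfPolygon

theorem integrableOn_rpow_mul_exp_neg_add_div (ν : ℝ) {c : ℝ} (hc : 0 < c) :
    IntegrableOn (fun s : ℝ => s ^ (ν - 1) * Real.exp (-(s + c / s))) (Ioi 0) := by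
  obtain ⟨k, hk⟩ := exists_nat_gt (-ν)
  have hGamma : IntegrableOn
      (fun s : ℝ => k.factorial / c ^ k * (Real.exp (-s) * s ^ (ν + k - 1))) (Ioi 0) :=
    (Real.GammaIntegral_convergent (by linarith)).const_mul _
  refine hGamma.mono' (by fun_prop) ?_
  filter_upwards [ae_restrict_mem measurableSet_Ioi] with s (hs : 0 < s)
  have hexp : Real.exp (-(c / s)) ≤ k.factorial * (s / c) ^ k := by
    have h := Real.pow_div_factorial_le_exp (c / s) (by positivity) k
    rw [Real.exp_neg, inv_le_comm₀ (Real.exp_pos _) (by positivity), ← inv_div c s, inv_pow,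
      ← div_eq_mul_inv, inv_div]
    exact h
  rw [Real.norm_of_nonneg (by positivity), neg_add, Real.exp_add]
  calc s ^ (ν - 1) * (Real.exp (-s) * Real.exp (-(c / s)))
      ≤ s ^ (ν - 1) * (Real.exp (-s) * (k.factorial * (s / c) ^ k)) := by gcongr
    _ = k.factorial / c ^ k * (Real.exp (-s) * (s ^ (ν - 1) * s ^ k)) := by
        rw [div_pow]; ring
    _ = k.factorial / c ^ k * (Real.exp (-s) * s ^ (ν + k - 1)) := by
        rw [← Real.rpow_add_natCast hs.ne']; ring_nf

theorem range_const_mul_exp {a : ℝ} (ha : 0 < a) :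
    range (fun t : ℝ => a * Real.exp t) = Ioi 0 := by
  ext s
  refine ⟨?_, fun (hs : 0 < s) => ⟨Real.log (s / a), ?_⟩⟩
  · rintro ⟨t, rfl⟩
    exact mul_pos ha (Real.exp_pos t)
  · simp only [Real.exp_log (div_pos hs ha), mul_div_cancel₀ s ha.ne']

section ExpSubstitution

variable {a : ℝ} (g : ℝ → ℝ)

theorem hasDerivWithinAt_const_mul_exp (t : ℝ) :
    HasDerivWithinAt (fun t : ℝ => a * Real.exp t) (a * Real.exp t) univ t :=
  ((Real.hasDerivAt_exp t).const_mul a).hasDerivWithinAt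

theorem injOn_const_mul_exp (ha : 0 < a) : InjOn (fun t : ℝ => a * Real.exp t) univ :=
  fun _ _ _ _ h => Real.exp_injective (mul_left_cancel₀ ha.ne' h)

theorem integrableOn_Ioi_iff_integrable_comp_const_mul_exp (ha : 0 < a) :
    IntegrableOn g (Ioi 0) ↔
      Integrable fun t : ℝ => a * Real.exp t * g (a * Real.exp t) := by
  rw [← range_const_mul_exp ha, ← image_univ, integrableOn_image_iff_integrableOn_abs_deriv_smul
    MeasurableSet.univ (fun t _ => hasDerivWithinAt_const_mul_exp t) (injOn_const_mul_exp ha),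
    integrableOn_univ]
  simp only [abs_of_pos (mul_pos ha (Real.exp_pos _)), smul_eq_mul]

theorem integral_Ioi_eq_integral_comp_const_mul_exp (ha : 0 < a) :
    ∫ s in Ioi 0, g s = ∫ t : ℝ, a * Real.exp t * g (a * Real.exp t) := by
  rw [← range_const_mul_exp ha, ← image_univ, integral_image_eq_integral_abs_deriv_smul
    MeasurableSet.univ (fun t _ => hasDerivWithinAt_const_mul_exp t) (injOn_const_mul_exp ha),
    setIntegral_univ]
  simp only [abs_of_pos (mul_pos ha (Real.exp_pos _)), smul_eq_mul]

end ExpSubstitution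

theorem integral_eq_integral_Ioi_add_comp_neg {f : ℝ → ℝ} (hf : Integrable f) :
    ∫ t, f t = ∫ t in Ioi 0, (f t + f (-t)) := by
  rw [integral_add hf.integrableOn hf.comp_neg.integrableOn, integral_comp_neg_Ioi, neg_zero,
    add_comm, intervalIntegral.integral_Iic_add_Ioi hf.integrableOn hf.integrableOn]

theorem mul_exp_mul_rpow_mul_exp_neg_add_div {a : ℝ} (ha : 0 < a) (ν t : ℝ) :
    a * Real.exp t * ((a * Real.exp t) ^ (ν - 1) *
      Real.exp (-(a * Real.exp t + a ^ 2 / (a * Real.exp t)))) =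
      a ^ ν * (Real.exp (ν * t) * Real.exp (-(2 * a) * Real.cosh t)) := by
  have hpos : 0 < a * Real.exp t := mul_pos ha (Real.exp_pos t)
  have hpow : a * Real.exp t * (a * Real.exp t) ^ (ν - 1) = a ^ ν * Real.exp (ν * t) := by
    rw [mul_comm, ← Real.rpow_add_one hpos.ne', sub_add_cancel,
      Real.mul_rpow ha.le (Real.exp_pos t).le, ← Real.exp_mul, mul_comm t]
  have hcosh : -(a * Real.exp t + a ^ 2 / (a * Real.exp t)) = -(2 * a) * Real.cosh t := by
    rw [Real.cosh_eq, Real.exp_neg]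
    field_simp
  rw [← mul_assoc, hpow, hcosh, mul_assoc]

theorem integrable_exp_mul_exp_neg_mul_cosh (ν : ℝ) {u : ℝ} (hu : 0 < u) :
    Integrable fun t : ℝ => Real.exp (ν * t) * Real.exp (-u * Real.cosh t) := by
  have ha : 0 < u / 2 := by positivity
  have h := (integrableOn_Ioi_iff_integrable_comp_const_mul_exp _ ha).1
    (integrableOn_rpow_mul_exp_neg_add_div ν (sq_pos_of_pos ha))
  simp only [mul_exp_mul_rpow_mul_exp_neg_add_div ha, mul_div_cancel₀ u two_ne_zero] at h
  exact (integrable_const_mul_iff (Real.rpow_pos_of_pos ha ν).ne'.isUnit _).1 h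

theorem integral_exp_mul_exp_neg_mul_cosh (ν : ℝ) {u : ℝ} (hu : 0 < u) :
    ∫ t : ℝ, Real.exp (ν * t) * Real.exp (-u * Real.cosh t) = 2 * besselK ν u := by
  rw [integral_eq_integral_Ioi_add_comp_neg (integrable_exp_mul_exp_neg_mul_cosh ν hu), besselK,
    ← integral_const_mul]
  congr 1 with t
  rw [Real.cosh_neg, Real.cosh_eq (ν * t), mul_neg]
  ring

theorem integral_rpow_mul_exp_neg_add_div (ν : ℝ) {u : ℝ} (hu : 0 < u) :
    ∫ s in Ioi (0 : ℝ), s ^ (ν - 1) * Real.exp (-(s + (u / 2) ^ 2 / s)) =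
      2 * (u / 2) ^ ν * besselK ν u := by
  have ha : 0 < u / 2 := by positivity
  rw [integral_Ioi_eq_integral_comp_const_mul_exp _ ha]
  simp only [mul_exp_mul_rpow_mul_exp_neg_add_div ha, mul_div_cancel₀ u two_ne_zero]
  rw [integral_const_mul, integral_exp_mul_exp_neg_mul_cosh ν hu]
  ring

theorem besselK_neg (ν u : ℝ) : besselK (-ν) u = besselK ν u := by
  simp only [besselK, neg_mul, Real.cosh_neg]

theorem measurable_besselK (ν : ℝ) : Measurable (besselK ν) := by
  have h : StronglyMeasurable fun p : ℝ × ℝ =>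
      Real.exp (-p.1 * Real.cosh p.2) * Real.cosh (ν * p.2) :=
    Continuous.stronglyMeasurable (by fun_prop)
  exact h.integral_prod_right.measurable

theorem image_sinh_half_Ioi : (fun t : ℝ => Real.sinh (t / 2)) '' Ioi 0 = Ioi 0 := by
  ext s
  constructor
  · rintro ⟨t, ht : 0 < t, rfl⟩
    exact Real.sinh_pos_iff.2 (half_pos ht)
  · intro hs
    exact ⟨2 * Real.arsinh s, mul_pos two_pos (Real.arsinh_pos_iff.2 hs), by simp⟩

theorem besselK_half (u : ℝ) :
    besselK (1 / 2) u = Real.sqrt (Real.pi / (2 * u)) * Real.exp (-u) := by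
  have hderiv : ∀ t ∈ Ioi (0 : ℝ), HasDerivWithinAt (fun t : ℝ => Real.sinh (t / 2))
      (Real.cosh (t / 2) / 2) (Ioi 0) t := fun t _ => by
    simpa [div_eq_mul_inv] using ((hasDerivAt_id t).div_const 2).sinh.hasDerivWithinAt
  have hinj : InjOn (fun t : ℝ => Real.sinh (t / 2)) (Ioi 0) := fun x _ y _ h => by
    linarith [Real.sinh_injective h]
  have hsubst := integral_image_eq_integral_abs_deriv_smul measurableSet_Ioi hderiv hinj
    (fun w => Real.exp (-(2 * u) * w ^ 2))
  rw [image_sinh_half_Ioi, integral_gaussian_Ioi] at hsubst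
  have hintegrand (t : ℝ) : Real.exp (-u * Real.cosh t) * Real.cosh (1 / 2 * t) =
      2 * Real.exp (-u) *
        (|Real.cosh (t / 2) / 2| • Real.exp (-(2 * u) * Real.sinh (t / 2) ^ 2)) := by
    have hcosh : -u * Real.cosh t = -u + -(2 * u) * Real.sinh (t / 2) ^ 2 := by
      rw [show t = 2 * (t / 2) by ring, Real.cosh_two_mul, Real.cosh_sq]
      ring_nf
    rw [abs_of_pos (half_pos (Real.cosh_pos _)), hcosh, Real.exp_add, smul_eq_mul,
      one_div_mul_eq_div]
    ring
  rw [besselK]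
  simp only [hintegrand]
  rw [integral_const_mul, ← hsubst]
  ring

section Gamma

instance (a r : ℝ) : SFinite (gammaMeasure a r) :=
  inferInstanceAs (SFinite (volume.withDensity (gammaPDF a r)))

theorem lintegral_gammaMeasure (a r : ℝ) {g : ℝ → ℝ≥0∞} (hg : Measurable g) :
    ∫⁻ s, g s ∂gammaMeasure a r = ∫⁻ s in Ioi 0,
      ENNReal.ofReal (r ^ a / Real.Gamma a * s ^ (a - 1) * Real.exp (-(r * s))) * g s := by
  have hvanish : ∫⁻ s in Iio 0, gammaPDF a r s * g s = 0 := by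
    refine setLIntegral_eq_zero measurableSet_Iio fun s hs => ?_
    simp only [gammaPDF_of_neg hs, zero_mul, Pi.zero_apply]
  have hmeas : Measurable (gammaPDF a r) := (measurable_gammaPDFReal a r).ennreal_ofReal
  rw [gammaMeasure, lintegral_withDensity_eq_lintegral_mul _ hmeas hg,
    ← lintegral_add_compl _ measurableSet_Ici, compl_Ici (a := (0 : ℝ))]
  simp only [Pi.mul_apply]
  rw [hvanish, add_zero, ← restrict_Ioi_eq_restrict_Ici]
  exact setLIntegral_congr_fun measurableSet_Ioi fun s (hs : 0 < s) => by
    simp only [gammaPDF_of_nonneg hs.le]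

theorem ae_gammaMeasure_pos (a r : ℝ) : ∀ᵐ s ∂gammaMeasure a r, 0 < s := by
  have hmeas : MeasurableSet {s : ℝ | ¬0 < s} :=
    (measurableSet_lt measurable_const measurable_id).compl
  rw [ae_iff, ← lintegral_indicator_one hmeas,
    lintegral_gammaMeasure a r (measurable_one.indicator hmeas)]
  refine setLIntegral_eq_zero measurableSet_Ioi fun s (hs : 0 < s) => ?_
  simp [hs]

theorem lintegral_exp_neg_mul_gammaMeasure {a b r : ℝ} (ha : 0 < a) (hr : 0 < r) (hb : 0 ≤ b) :
    ∫⁻ s, ENNReal.ofReal (Real.exp (-(b * s))) ∂gammaMeasure a r =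
      ENNReal.ofReal ((r / (r + b)) ^ a) := by
  have hrb : 0 < r + b := by positivity
  have hint : IntegrableOn (fun s : ℝ => s ^ (a - 1) * Real.exp (-((r + b) * s))) (Ioi 0) := by
    simpa only [neg_mul, Real.rpow_one] using
      integrableOn_rpow_mul_exp_neg_mul_rpow (by linarith : -1 < a - 1) one_pos hrb
  have hcombine : EqOn
      (fun s : ℝ => ENNReal.ofReal (r ^ a / Real.Gamma a * s ^ (a - 1) * Real.exp (-(r * s))) *
        ENNReal.ofReal (Real.exp (-(b * s))))
      (fun s : ℝ => ENNReal.ofReal (r ^ a / Real.Gamma a) *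
        ENNReal.ofReal (s ^ (a - 1) * Real.exp (-((r + b) * s)))) (Ioi 0) := by
    intro s (hs : 0 < s)
    simp only
    rw [← ENNReal.ofReal_mul (by positivity), ← ENNReal.ofReal_mul (by positivity), add_mul,
      neg_add, Real.exp_add]
    ring_nf
  have hnonneg : 0 ≤ᵐ[volume.restrict (Ioi 0)]
      fun s : ℝ => s ^ (a - 1) * Real.exp (-((r + b) * s)) := by
    filter_upwards [ae_restrict_mem measurableSet_Ioi] with s (hs : 0 < s)
    positivity
  rw [lintegral_gammaMeasure a r (by fun_prop), setLIntegral_congr_fun measurableSet_Ioi hcombine,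
    lintegral_const_mul _ (by fun_prop), ← ofReal_integral_eq_lintegral_ofReal hint hnonneg,
    Real.integral_rpow_mul_exp_neg_mul_Ioi ha hrb, ← ENNReal.ofReal_mul (by positivity),
    Real.div_rpow hr.le hrb.le, Real.div_rpow zero_le_one hrb.le, Real.one_rpow]
  have hΓ := (Real.Gamma_pos_of_pos ha).ne'
  congr 1
  field_simp

end Gamma

section HeatKernel

/-- The heat kernel of a `d`-dimensional Euclidean space at time `τ`, as a function of the
distance `r` (the density of the centred Gaussian law with variance `2τ` in each coordinate). -/
def heatKernel (d : ℕ) (τ r : ℝ) : ℝ :=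
  (4 * Real.pi * τ) ^ (-(d / 2 : ℝ)) * Real.exp (-(r ^ 2 / (4 * τ)))

variable {d : ℕ} {τ : ℝ}

theorem heatKernel_nonneg (hτ : 0 ≤ τ) (r : ℝ) : 0 ≤ heatKernel d τ r := by
  unfold heatKernel
  positivity

theorem heatKernel_le_of_sq_le (hτ : 0 ≤ τ) {r r' : ℝ} (h : r' ^ 2 ≤ r ^ 2) :
    heatKernel d τ r ≤ heatKernel d τ r' := by
  unfold heatKernel
  gcongr

theorem measurable_heatKernel : Measurable fun p : ℝ × ℝ => heatKernel d p.1 p.2 := by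
  unfold heatKernel
  fun_prop

theorem continuous_heatKernel : Continuous (heatKernel d τ) := by
  unfold heatKernel
  fun_prop

variable {V : Type*} [NormedAddCommGroup V] [InnerProductSpace ℝ V]

theorem heatKernel_mul_cexp_inner (x t : V) :
    heatKernel d τ ‖x‖ • Complex.exp (inner ℝ x t * Complex.I) =
      ((4 * Real.pi * τ) ^ (-(d / 2 : ℝ)) : ℝ) *
        Complex.exp (-((4 * τ : ℝ)⁻¹ : ℂ) * ‖x‖ ^ 2 + Complex.I * inner ℝ t x) := by
  rw [heatKernel, Complex.exp_add, real_inner_comm, Complex.real_smul]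
  push_cast
  ring_nf

variable [FiniteDimensional ℝ V] [MeasurableSpace V] [BorelSpace V]

theorem integrable_heatKernel_smul_cexp_inner (hτ : 0 < τ) (t : V) :
    Integrable fun x : V => heatKernel d τ ‖x‖ • Complex.exp (inner ℝ x t * Complex.I) := by
  simp only [heatKernel_mul_cexp_inner]
  exact (GaussianFourier.integrable_cexp_neg_mul_sq_norm_add
    (by rw [← Complex.ofReal_inv, Complex.ofReal_re]; positivity) _ t).const_mul _

theorem integral_heatKernel_smul_cexp_inner (hτ : 0 < τ) (t : V) :
    ∫ x : V, heatKernel (Module.finrank ℝ V) τ ‖x‖ • Complex.exp (inner ℝ x t * Complex.I) =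
      (Real.exp (-(τ * ‖t‖ ^ 2)) : ℝ) := by
  have h4τ : (0 : ℝ) < 4 * Real.pi * τ := by positivity
  have hτ' : (τ : ℂ) ≠ 0 := by exact_mod_cast hτ.ne'
  simp only [heatKernel_mul_cexp_inner]
  rw [integral_const_mul, GaussianFourier.integral_cexp_neg_mul_sq_norm_add
    (by rw [← Complex.ofReal_inv, Complex.ofReal_re]; positivity) _ t, ← mul_assoc]
  have hpow : (((4 * Real.pi * τ) ^ (-(Module.finrank ℝ V / 2 : ℝ)) : ℝ) : ℂ) *
      (Real.pi / ((4 * τ : ℝ)⁻¹ : ℂ)) ^ (Module.finrank ℝ V / 2 : ℂ) = 1 := by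
    rw [show (Real.pi / ((4 * τ : ℝ)⁻¹ : ℂ)) = ((4 * Real.pi * τ : ℝ) : ℂ) by
        push_cast; field_simp,
      show (Module.finrank ℝ V / 2 : ℂ) = ((Module.finrank ℝ V / 2 : ℝ) : ℂ) by push_cast; rfl,
      ← Complex.ofReal_cpow h4τ.le, ← Complex.ofReal_mul, ← Real.rpow_add h4τ, neg_add_cancel,
      Real.rpow_zero, Complex.ofReal_one]
  rw [hpow, one_mul, Complex.I_sq]
  push_cast
  congr 1
  field_simp

theorem lintegral_heatKernel (hτ : 0 < τ) :
    ∫⁻ x : V, ENNReal.ofReal (heatKernel (Module.finrank ℝ V) τ ‖x‖) = 1 := by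
  have hintegrable := integrable_heatKernel_smul_cexp_inner (d := Module.finrank ℝ V) hτ (0 : V)
  have hintegral := integral_heatKernel_smul_cexp_inner hτ (0 : V)
  simp only [inner_zero_right, Complex.ofReal_zero, zero_mul, Complex.exp_zero, Complex.real_smul,
    mul_one, norm_zero, zero_pow two_ne_zero, mul_zero, neg_zero, Real.exp_zero,
    integral_complex_ofReal, Complex.ofReal_inj] at hintegrable hintegral
  rw [← ofReal_integral_eq_lintegral_ofReal (by simpa using hintegrable.re)
    (Eventually.of_forall fun x => heatKernel_nonneg hτ.le _), hintegral, ENNReal.ofReal_one]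

end HeatKernel

/-- The density, as a function of the distance `r` to the origin, of the `d`-dimensional symmetric
variance-gamma law, the law of a Brownian motion at an independent gamma-distributed time: the
heat kernel at time `σ² s` averaged over `s` with the gamma law of shape `α` and rate `1`.
It is `∞` at `r = 0` when `α ≤ d / 2`. -/
def varianceGammaPDF (d : ℕ) (σ α r : ℝ) : ℝ≥0∞ :=
  ∫⁻ s, ENNReal.ofReal (heatKernel d (σ ^ 2 * s) r) ∂gammaMeasure α 1

section VarianceGammaPDF

variable {d : ℕ} {σ α r : ℝ}

theorem measurable_ofReal_heatKernel (σ : ℝ) : Measurable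
    fun p : ℝ × ℝ => ENNReal.ofReal (heatKernel d (σ ^ 2 * p.2) p.1) :=
  (measurable_heatKernel.comp
    (((measurable_const_mul _).comp measurable_snd).prodMk measurable_fst)).ennreal_ofReal

theorem varianceGammaPDF_eq_lintegral (hσ : 0 < σ) (hα : 0 < α) (r : ℝ) :
    varianceGammaPDF d σ α r =
      ENNReal.ofReal ((Real.Gamma α * (4 * Real.pi * σ ^ 2) ^ (d / 2 : ℝ))⁻¹) *
        ∫⁻ s in Ioi (0 : ℝ), ENNReal.ofReal
          (s ^ (α - d / 2 - 1) * Real.exp (-(s + (r / σ / 2) ^ 2 / s))) := by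
  have hmeas : Measurable fun s => ENNReal.ofReal (heatKernel d (σ ^ 2 * s) r) :=
    (measurable_ofReal_heatKernel σ).comp measurable_prodMk_left
  rw [varianceGammaPDF, lintegral_gammaMeasure _ _ hmeas, ← lintegral_const_mul _ (by fun_prop)]
  refine setLIntegral_congr_fun measurableSet_Ioi fun s (hs : 0 < s) => ?_
  rw [← ENNReal.ofReal_mul (by positivity), ← ENNReal.ofReal_mul (by positivity), heatKernel]
  congr 1
  have htime : (4 * Real.pi * (σ ^ 2 * s)) ^ (-(d / 2 : ℝ)) =
      ((4 * Real.pi * σ ^ 2) ^ (d / 2 : ℝ))⁻¹ * s ^ (-(d / 2 : ℝ)) := by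
    rw [← mul_assoc, Real.mul_rpow (by positivity) hs.le, Real.rpow_neg (by positivity)]
  have hpow : s ^ (α - d / 2 - 1) = s ^ (α - 1) * s ^ (-(d / 2 : ℝ)) := by
    rw [← Real.rpow_add hs]
    ring_nf
  have hexp : Real.exp (-(s + (r / σ / 2) ^ 2 / s)) =
      Real.exp (-(1 * s)) * Real.exp (-(r ^ 2 / (4 * (σ ^ 2 * s)))) := by
    rw [← Real.exp_add]
    congr 1
    field_simp
    ring
  rw [htime, hpow, hexp, Real.one_rpow, mul_inv]
  ring

theorem varianceGammaPDF_of_pos (hσ : 0 < σ) (hα : 0 < α) (hr : 0 < r) :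
    varianceGammaPDF d σ α r = ENNReal.ofReal
      ((Real.Gamma α * (4 * Real.pi * σ ^ 2) ^ (d / 2 : ℝ))⁻¹ *
        (2 * (r / σ / 2) ^ (α - d / 2) * besselK (α - d / 2) (r / σ))) := by
  have hnonneg : 0 ≤ᵐ[volume.restrict (Ioi 0)]
      fun s : ℝ => s ^ (α - d / 2 - 1) * Real.exp (-(s + (r / σ / 2) ^ 2 / s)) := by
    filter_upwards [ae_restrict_mem measurableSet_Ioi] with s (hs : 0 < s)
    positivity
  rw [varianceGammaPDF_eq_lintegral hσ hα, ← ofReal_integral_eq_lintegral_ofReal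
      (integrableOn_rpow_mul_exp_neg_add_div _ (by positivity)) hnonneg,
    integral_rpow_mul_exp_neg_add_div _ (div_pos hr hσ), ← ENNReal.ofReal_mul (by positivity)]

theorem varianceGammaPDF_zero (hσ : 0 < σ) (hd : 0 < α - d / 2) :
    varianceGammaPDF d σ α 0 = ENNReal.ofReal
      ((Real.Gamma α * (4 * Real.pi * σ ^ 2) ^ (d / 2 : ℝ))⁻¹ * Real.Gamma (α - d / 2)) := by
  have hα : 0 < α := by linarith [show (0 : ℝ) ≤ d / 2 by positivity]
  have hnonneg : 0 ≤ᵐ[volume.restrict (Ioi 0)]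
      fun s : ℝ => Real.exp (-s) * s ^ (α - d / 2 - 1) := by
    filter_upwards [ae_restrict_mem measurableSet_Ioi] with s (hs : 0 < s)
    positivity
  rw [varianceGammaPDF_eq_lintegral hσ hα, Real.Gamma_eq_integral hd,
    ENNReal.ofReal_mul (by positivity), ofReal_integral_eq_lintegral_ofReal
      (Real.GammaIntegral_convergent hd) hnonneg]
  simp only [zero_div, zero_pow two_ne_zero, add_zero, mul_comm (Real.exp _)]

theorem varianceGammaPDF_le_of_sq_le {r' : ℝ} (h : r' ^ 2 ≤ r ^ 2) :
    varianceGammaPDF d σ α r ≤ varianceGammaPDF d σ α r' := by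
  refine lintegral_mono_ae ?_
  filter_upwards [ae_gammaMeasure_pos α 1] with s hs
  exact ENNReal.ofReal_le_ofReal (heatKernel_le_of_sq_le (by positivity) h)

theorem continuousAt_varianceGammaPDF_zero : ContinuousAt (varianceGammaPDF d σ α) 0 := by
  refine tendsto_of_le_liminf_of_limsup_le ?_ ?_
  · refine le_trans (lintegral_mono fun s => ?_)
      (lintegral_liminf_le fun r => (measurable_ofReal_heatKernel σ).comp measurable_prodMk_left)
    exact (ENNReal.continuous_ofReal.comp continuous_heatKernel).continuousAt.liminf_eq.ge
  · refine limsup_le_of_le (h := Eventually.of_forall fun r => varianceGammaPDF_le_of_sq_le ?_)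
    simpa using sq_nonneg r

theorem continuousAt_varianceGammaPDF (hσ : 0 < σ) (hα : 0 < α) (hr : r ≠ 0) :
    ContinuousAt (varianceGammaPDF d σ α) r := by
  have hfinite : varianceGammaPDF d σ α (|r| / 2) ≠ ∞ := by
    rw [varianceGammaPDF_of_pos hσ hα (by positivity)]
    exact ENNReal.ofReal_ne_top
  refine tendsto_lintegral_filter_of_dominated_convergence _ (Eventually.of_forall fun r' =>
    (measurable_ofReal_heatKernel σ).comp measurable_prodMk_left) ?_ hfinite
    (ae_of_all _ fun s => (ENNReal.continuous_ofReal.comp continuous_heatKernel).continuousAt)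
  filter_upwards [continuous_abs.continuousAt.eventually_const_lt (half_lt_self (abs_pos.2 hr))]
    with r' hr'
  filter_upwards [ae_gammaMeasure_pos α 1] with s hs
  refine ENNReal.ofReal_le_ofReal (heatKernel_le_of_sq_le (by positivity) ?_)
  rw [sq_le_sq, abs_of_nonneg (by positivity : 0 ≤ |r| / 2)]
  exact hr'.le

theorem continuous_varianceGammaPDF (hσ : 0 < σ) (hα : 0 < α) :
    Continuous (varianceGammaPDF d σ α) := by
  refine continuous_iff_continuousAt.2 fun r => ?_
  rcases eq_or_ne r 0 with rfl | hr
  · exact continuousAt_varianceGammaPDF_zero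
  · exact continuousAt_varianceGammaPDF hσ hα hr

end VarianceGammaPDF

section VarianceGamma

variable {V : Type*} [NormedAddCommGroup V] [InnerProductSpace ℝ V] [MeasurableSpace V]
  [BorelSpace V]

theorem measurable_varianceGammaPDF_norm (σ α : ℝ) :
    Measurable fun x : V => varianceGammaPDF (Module.finrank ℝ V) σ α ‖x‖ :=
  (measurable_ofReal_heatKernel σ).lintegral_prod_right'.comp measurable_norm

theorem measurable_ofReal_heatKernel_norm (σ : ℝ) : Measurable fun p : ℝ × V =>
    ENNReal.ofReal (heatKernel (Module.finrank ℝ V) (σ ^ 2 * p.1) ‖p.2‖) :=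
  (measurable_ofReal_heatKernel σ).comp (measurable_snd.norm.prodMk measurable_fst)

theorem continuous_lintegral_varianceGammaPDF_sub {σ β : ℝ} (hσ : 0 < σ)
    (hβ : 0 < β - Module.finrank ℝ V / 2) (μ : Measure V) [IsFiniteMeasure μ] :
    Continuous fun x : V => ∫⁻ y, varianceGammaPDF (Module.finrank ℝ V) σ β ‖x - y‖ ∂μ := by
  have hβ' : 0 < β := by linarith [show (0 : ℝ) ≤ Module.finrank ℝ V / 2 by positivity]
  refine continuous_iff_continuousAt.2 fun x => tendsto_lintegral_filter_of_dominated_convergence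
    (fun _ => varianceGammaPDF (Module.finrank ℝ V) σ β 0)
    (Eventually.of_forall fun x =>
      (measurable_varianceGammaPDF_norm σ β).comp (measurable_const_sub x))
    (Eventually.of_forall fun x => ae_of_all _ fun y => varianceGammaPDF_le_of_sq_le (by simp)) ?_
    (ae_of_all _ fun y =>
      ((continuous_varianceGammaPDF hσ hβ').comp
        (continuous_norm.comp (continuous_sub_right y))).continuousAt)
  rw [lintegral_const, varianceGammaPDF_zero hσ hβ]
  exact ENNReal.mul_ne_top ENNReal.ofReal_ne_top (measure_ne_top _ _)

variable [FiniteDimensional ℝ V] {σ α β : ℝ}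

variable (V) in
/-- The symmetric variance-gamma law with scale `σ` and shape `α` on a Euclidean space. -/
def varianceGamma (σ α : ℝ) : Measure V :=
  volume.withDensity fun x => varianceGammaPDF (Module.finrank ℝ V) σ α ‖x‖

variable (V) in
/-- The joint law of the gamma time `s` and of the position at time `σ² s` of the Brownian motion
defining the variance-gamma law. -/
def varianceGammaJoint (σ α : ℝ) : Measure (ℝ × V) :=
  ((gammaMeasure α 1).prod volume).withDensity fun p =>
    ENNReal.ofReal (heatKernel (Module.finrank ℝ V) (σ ^ 2 * p.1) ‖p.2‖)

theorem map_snd_varianceGammaJoint (σ α : ℝ) :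
    (varianceGammaJoint V σ α).map Prod.snd = varianceGamma V σ α := by
  refine Measure.ext_of_lintegral _ fun f hf => ?_
  have hmeas := measurable_ofReal_heatKernel_norm (V := V) σ
  have hf_snd : Measurable fun p : ℝ × V => f p.2 := hf.comp measurable_snd
  rw [lintegral_map hf measurable_snd, varianceGammaJoint, varianceGamma,
    lintegral_withDensity_eq_lintegral_mul _ hmeas hf_snd,
    lintegral_withDensity_eq_lintegral_mul _ (measurable_varianceGammaPDF_norm _ _) hf,
    lintegral_prod_symm _ (hmeas.mul hf_snd).aemeasurable]
  simp only [Pi.mul_apply, varianceGammaPDF]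
  refine lintegral_congr fun x => lintegral_mul_const (f x) ?_
  exact hmeas.comp measurable_prodMk_right

theorem isProbabilityMeasure_varianceGammaJoint (hσ : 0 < σ) (hα : 0 < α) :
    IsProbabilityMeasure (varianceGammaJoint V σ α) := by
  have := isProbabilityMeasure_gammaMeasure hα one_pos
  refine ⟨?_⟩
  rw [varianceGammaJoint, withDensity_apply _ MeasurableSet.univ, Measure.restrict_univ,
    lintegral_prod _ (measurable_ofReal_heatKernel_norm σ).aemeasurable]
  trans ∫⁻ _, 1 ∂gammaMeasure α 1
  · refine lintegral_congr_ae ?_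
    filter_upwards [ae_gammaMeasure_pos α 1] with s hs
    exact lintegral_heatKernel (by positivity)
  · rw [lintegral_one, measure_univ]

theorem isProbabilityMeasure_varianceGamma (hσ : 0 < σ) (hα : 0 < α) :
    IsProbabilityMeasure (varianceGamma V σ α) := by
  have := isProbabilityMeasure_varianceGammaJoint (V := V) hσ hα
  rw [← map_snd_varianceGammaJoint]
  exact Measure.isProbabilityMeasure_map measurable_snd.aemeasurable

theorem integral_exp_neg_mul_gammaMeasure {a b r : ℝ} (ha : 0 < a) (hr : 0 < r) (hb : 0 ≤ b) :
    ∫ s, Real.exp (-(b * s)) ∂gammaMeasure a r = (r / (r + b)) ^ a := by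
  rw [integral_eq_lintegral_of_nonneg_ae (ae_of_all _ fun s => (Real.exp_pos _).le) (by fun_prop),
    lintegral_exp_neg_mul_gammaMeasure ha hr hb, ENNReal.toReal_ofReal (by positivity)]

theorem charFun_varianceGamma (hσ : 0 < σ) (hα : 0 < α) (t : V) :
    charFun (varianceGamma V σ α) t = ((1 / (1 + σ ^ 2 * ‖t‖ ^ 2)) ^ α : ℝ) := by
  have := isProbabilityMeasure_gammaMeasure hα one_pos
  have := isProbabilityMeasure_varianceGammaJoint (V := V) hσ hα
  have hmeas := measurable_ofReal_heatKernel_norm (V := V) σ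
  have hintegrable : Integrable (fun p : ℝ × V => Complex.exp (inner ℝ p.2 t * Complex.I))
      (varianceGammaJoint V σ α) := by
    refine Integrable.of_bound (by fun_prop) 1 (ae_of_all _ fun p => ?_)
    rw [Complex.norm_exp_ofReal_mul_I]
  rw [varianceGammaJoint, integrable_withDensity_iff_integrable_smul' hmeas
    (ae_of_all _ fun p => ENNReal.ofReal_lt_top)] at hintegrable
  rw [← map_snd_varianceGammaJoint, charFun_apply, integral_map (by fun_prop) (by fun_prop),
    varianceGammaJoint, integral_withDensity_eq_integral_toReal_smul hmeas
      (ae_of_all _ fun p => ENNReal.ofReal_lt_top), integral_prod _ hintegrable]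
  trans ∫ s, ((Real.exp (-(σ ^ 2 * ‖t‖ ^ 2 * s)) : ℝ) : ℂ) ∂gammaMeasure α 1
  · refine integral_congr_ae ?_
    filter_upwards [ae_gammaMeasure_pos α 1] with s hs
    simp only [ENNReal.toReal_ofReal (heatKernel_nonneg (by positivity : 0 ≤ σ ^ 2 * s) _)]
    rw [integral_heatKernel_smul_cexp_inner (by positivity), mul_right_comm]
  · rw [integral_complex_ofReal, integral_exp_neg_mul_gammaMeasure hα one_pos (by positivity)]

theorem varianceGamma_conv (hσ : 0 < σ) (hα : 0 < α) (hβ : 0 < β) :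
    varianceGamma V σ α ∗ varianceGamma V σ β = varianceGamma V σ (α + β) := by
  have := isProbabilityMeasure_varianceGamma (V := V) hσ hα
  have := isProbabilityMeasure_varianceGamma (V := V) hσ hβ
  have := isProbabilityMeasure_varianceGamma (V := V) hσ (add_pos hα hβ)
  refine Measure.ext_of_charFun (funext fun t => ?_)
  rw [charFun_conv, charFun_varianceGamma hσ hα, charFun_varianceGamma hσ hβ,
    charFun_varianceGamma hσ (add_pos hα hβ), Real.rpow_add (by positivity), Complex.ofReal_mul]

theorem varianceGamma_conv_eq_withDensity (σ α β : ℝ) :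
    varianceGamma V σ α ∗ varianceGamma V σ β = volume.withDensity fun x =>
      ∫⁻ y, varianceGammaPDF (Module.finrank ℝ V) σ β ‖x - y‖ ∂varianceGamma V σ α := by
  have hmeas (γ : ℝ) := measurable_varianceGammaPDF_norm (V := V) σ γ
  rw [varianceGamma, varianceGamma, conv_withDensity_eq_lconvolution (hmeas α) (hmeas β)]
  congr 1 with x
  have hmeas_sub : Measurable fun y : V => varianceGammaPDF (Module.finrank ℝ V) σ β ‖x - y‖ :=
    (hmeas β).comp (measurable_const_sub x)
  rw [lconvolution_def, lintegral_withDensity_eq_lintegral_mul _ (hmeas α) hmeas_sub]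
  simp only [Pi.mul_apply, neg_add_eq_sub]

theorem lintegral_varianceGammaPDF_sub_comm (σ α β : ℝ) (x : V) :
    ∫⁻ y, varianceGammaPDF (Module.finrank ℝ V) σ β ‖x - y‖ ∂varianceGamma V σ α =
      ∫⁻ y, varianceGammaPDF (Module.finrank ℝ V) σ α ‖x - y‖ ∂varianceGamma V σ β := by
  have hmeas (γ : ℝ) := measurable_varianceGammaPDF_norm (V := V) σ γ
  have hmeas_sub (γ : ℝ) :
      Measurable fun y : V => varianceGammaPDF (Module.finrank ℝ V) σ γ ‖x - y‖ :=
    (hmeas γ).comp (measurable_const_sub x)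
  rw [varianceGamma, varianceGamma, lintegral_withDensity_eq_lintegral_mul _ (hmeas α)
    (hmeas_sub β), lintegral_withDensity_eq_lintegral_mul _ (hmeas β) (hmeas_sub α),
    ← lintegral_sub_left_eq_self _ x]
  simp only [Pi.mul_apply, sub_sub_cancel, mul_comm]

theorem lintegral_varianceGammaPDF_sub (hσ : 0 < σ) (hα : 0 < α)
    (hβ : 0 < β - Module.finrank ℝ V / 2) (x : V) :
    ∫⁻ y, varianceGammaPDF (Module.finrank ℝ V) σ β ‖x - y‖ ∂varianceGamma V σ α =
      varianceGammaPDF (Module.finrank ℝ V) σ (α + β) ‖x‖ := by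
  have hβ' : 0 < β := by linarith [show (0 : ℝ) ≤ Module.finrank ℝ V / 2 by positivity]
  have := isProbabilityMeasure_varianceGamma (V := V) hσ hα
  have hcont := continuous_lintegral_varianceGammaPDF_sub hσ hβ (varianceGamma V σ α)
  have hpdf : Continuous fun x : V => varianceGammaPDF (Module.finrank ℝ V) σ (α + β) ‖x‖ :=
    (continuous_varianceGammaPDF hσ (add_pos hα hβ')).comp continuous_norm
  refine congrFun ((Continuous.ae_eq_iff_eq (volume : Measure V) hcont hpdf).1 ?_) x
  rw [← withDensity_eq_iff_of_sigmaFinite hcont.measurable.aemeasurable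
    (measurable_varianceGammaPDF_norm _ _).aemeasurable, ← varianceGamma_conv_eq_withDensity,
    varianceGamma_conv hσ hα hβ', varianceGamma]

end VarianceGamma

section HopfMap

theorem hopf_quat (q : Fin 4 → ℝ) :
    hopf (quat q) = !₂[q 0 ^ 2 + q 1 ^ 2 - q 2 ^ 2 - q 3 ^ 2,
      2 * (q 1 * q 2 - q 0 * q 3), 2 * (q 1 * q 3 + q 0 * q 2)] := by
  have hre (q) : (quat q).re = q 0 := rfl
  have himI (q) : (quat q).imI = q 1 := rfl
  have himJ (q) : (quat q).imJ = q 2 := rfl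
  have himK (q) : (quat q).imK = q 3 := rfl
  ext i
  fin_cases i <;> simp [hopf, hre, himI, himJ, himK] <;> ring

theorem hopf_eq (q : ℍ[ℝ]) :
    hopf q = !₂[q.re ^ 2 + q.imI ^ 2 - q.imJ ^ 2 - q.imK ^ 2,
      2 * (q.imI * q.imJ - q.re * q.imK), 2 * (q.imI * q.imK + q.re * q.imJ)] :=
  hopf_quat ![q.re, q.imI, q.imJ, q.imK]

@[fun_prop]
theorem continuous_hopf_quat : Continuous fun q : Fin 4 → ℝ => hopf (quat q) := by
  simp only [hopf_quat]
  refine (PiLp.continuous_toLp 2 _).comp (continuous_pi fun i => ?_)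
  fin_cases i
  · change Continuous fun q : Fin 4 → ℝ => q 0 ^ 2 + q 1 ^ 2 - q 2 ^ 2 - q 3 ^ 2
    fun_prop
  · change Continuous fun q : Fin 4 → ℝ => 2 * (q 1 * q 2 - q 0 * q 3)
    fun_prop
  · change Continuous fun q : Fin 4 → ℝ => 2 * (q 1 * q 3 + q 0 * q 2)
    fun_prop

theorem hopf_smul (c : ℝ) (q : ℍ[ℝ]) : hopf (c • q) = c ^ 2 • hopf q := by
  ext i
  fin_cases i <;> simp [hopf_eq] <;> ring

-- `⟪p̄ 𝐢 p, ū 𝐢 u⟫ = ⟪u p̄ 𝐢 p ū, 𝐢⟫`, as `v ↦ u v ū` is the adjoint of `v ↦ ū v u`.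
theorem inner_hopf_hopf (p u : ℍ[ℝ]) : inner ℝ (hopf p) (hopf u) = hopf (p * star u) 0 := by
  simp [hopf_eq, PiLp.inner_apply, Fin.sum_univ_three]
  ring

theorem norm_hopf (q : ℍ[ℝ]) : ‖hopf q‖ = ‖q‖ ^ 2 := by
  rw [← sq_eq_sq₀ (norm_nonneg _) (by positivity), ← real_inner_self_eq_norm_sq, inner_hopf_hopf,
    Quaternion.self_mul_star, Quaternion.normSq_eq_norm_mul_self]
  simp [hopf_eq]
  ring

theorem hopf_surjective : Function.Surjective hopf := by
  intro t
  have hnorm : ‖t‖ ^ 2 = t 0 ^ 2 + t 1 ^ 2 + t 2 ^ 2 := by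
    rw [EuclideanSpace.real_norm_sq_eq, Fin.sum_univ_three]
  have habs : |t 0| ≤ ‖t‖ := PiLp.norm_apply_le t 0
  rcases (neg_le_of_abs_le habs).eq_or_lt with hpole | hpole
  · rw [← hpole, neg_sq] at hnorm
    have h1 : t 1 = 0 := pow_eq_zero_iff two_ne_zero |>.1 (by nlinarith [sq_nonneg (t 2)])
    have h2 : t 2 = 0 := pow_eq_zero_iff two_ne_zero |>.1 (by nlinarith [sq_nonneg (t 1)])
    refine ⟨quat ![0, 0, √‖t‖, 0], ?_⟩
    ext i
    fin_cases i <;> simp [hopf_quat, h1, h2, ← hpole]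
  · set p := √((‖t‖ + t 0) / 2)
    have hp : 0 < p := Real.sqrt_pos.2 (by linarith)
    have hp_sq : p ^ 2 = (‖t‖ + t 0) / 2 := Real.sq_sqrt (by linarith)
    refine ⟨quat ![0, p, t 1 / (2 * p), t 2 / (2 * p)], ?_⟩
    ext i
    fin_cases i <;> simp [hopf_quat] <;> field_simp
    rw [← sub_eq_zero]
    have : p ^ 4 = ((‖t‖ + t 0) / 2) ^ 2 := by rw [← hp_sq]; ring
    linear_combination 4 * this - 4 * t 0 * hp_sq + hnorm

end HopfMap

section HopfLaw

/-- The law of a single Hopf-Gaussian edge. -/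
def hopfLaw : Measure E3 :=
  (Measure.pi fun _ : Fin 4 => gaussianReal 0 1).map fun q => hopf (quat q)

instance : IsProbabilityMeasure hopfLaw :=
  Measure.isProbabilityMeasure_map continuous_hopf_quat.aemeasurable

theorem hopfGaussianArm_eq_pi (n : ℕ) : hopfGaussianArm n = Measure.pi fun _ => hopfLaw := by
  unfold hopfGaussianArm gaussianHn hopfLaw
  rw [← Measure.pi_map_pi (fun _ => continuous_hopf_quat.aemeasurable)]

theorem measurePreserving_linearIsometryEquiv_pi_gaussianReal {ι : Type*} [Fintype ι]
    (e : EuclideanSpace ℝ ι ≃ₗᵢ[ℝ] EuclideanSpace ℝ ι) :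
    MeasurePreserving (fun q : ι → ℝ => (e (WithLp.toLp 2 q)).ofLp)
      (Measure.pi fun _ => gaussianReal 0 1) (Measure.pi fun _ => gaussianReal 0 1) := by
  have hto : MeasurePreserving (WithLp.toLp 2) (Measure.pi fun _ : ι => gaussianReal 0 1)
      (stdGaussian (EuclideanSpace ℝ ι)) := ⟨by fun_prop, map_pi_eq_stdGaussian⟩
  have hiso : MeasurePreserving e (stdGaussian _) (stdGaussian _) :=
    ⟨e.continuous.measurable, stdGaussian_map e⟩
  have hof : MeasurePreserving WithLp.ofLp (stdGaussian (EuclideanSpace ℝ ι))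
      (Measure.pi fun _ : ι => gaussianReal 0 1) :=
    hto.symm (MeasurableEquiv.toLp 2 (ι → ℝ))
  exact hof.comp (hiso.comp hto)

/-- Right multiplication by a unit quaternion. -/
def mulRightIsometry (w : ℍ[ℝ]) (hw : ‖w‖ = 1) : ℍ[ℝ] ≃ₗᵢ[ℝ] ℍ[ℝ] :=
  LinearIsometry.toLinearIsometryEquiv
    { LinearMap.mulRight ℝ w with norm_map' := fun q => by simp [hw] } rfl

theorem integral_quat_mul {w : ℍ[ℝ]} (hw : ‖w‖ = 1) (F : ℍ[ℝ] → ℂ) :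
    ∫ q, F (quat q * w) ∂(Measure.pi fun _ => gaussianReal 0 1) =
      ∫ q, F (quat q) ∂(Measure.pi fun _ => gaussianReal 0 1) := by
  let τ := Quaternion.linearIsometryEquivTuple
  let e := (τ.symm.trans (mulRightIsometry w hw)).trans τ
  have hemb : MeasurableEmbedding fun q : Fin 4 → ℝ => (e (WithLp.toLp 2 q)).ofLp :=
    (((MeasurableEquiv.toLp 2 (Fin 4 → ℝ)).trans e.toMeasurableEquiv).trans
      (MeasurableEquiv.toLp 2 (Fin 4 → ℝ)).symm).measurableEmbedding
  exact (measurePreserving_linearIsometryEquiv_pi_gaussianReal e).integral_comp hemb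
    fun q => F (quat q)

theorem integral_cexp_mul_sq_gaussianReal_sq {b : ℂ} (hb : b.re < 1 / 2) :
    (∫ x, Complex.exp (b * x ^ 2) ∂gaussianReal 0 1) ^ 2 = (1 - 2 * b)⁻¹ := by
  have hre : 0 < (1 / 2 - b).re := by simpa using hb
  have hpdf (x : ℝ) : gaussianPDFReal 0 1 x • Complex.exp (b * x ^ 2) =
      ((√(2 * Real.pi))⁻¹ : ℝ) * Complex.exp (-(1 / 2 - b) * x ^ 2) := by
    rw [Complex.real_smul, gaussianPDFReal, Complex.ofReal_mul, mul_assoc, Complex.ofReal_exp,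
      ← Complex.exp_add]
    simp only [NNReal.coe_one, mul_one, sub_zero]
    congr 2
    push_cast
    ring
  simp only [integral_gaussianReal_eq_integral_smul one_ne_zero, hpdf, integral_const_mul]
  rw [integral_gaussian_complex hre, mul_pow, ← Complex.cpow_nat_mul, ← Complex.ofReal_pow,
    inv_pow, Real.sq_sqrt (by positivity)]
  norm_num
  field_simp

theorem integral_cexp_hopf_quat_zero (s : ℝ) :
    ∫ q, Complex.exp (((s * hopf (quat q) 0 : ℝ) : ℂ) * Complex.I)
      ∂(Measure.pi fun _ => gaussianReal 0 1) = ((1 + 4 * s ^ 2)⁻¹ : ℝ) := by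
  let c : Fin 4 → ℂ := ![s * Complex.I, s * Complex.I, -(s * Complex.I), -(s * Complex.I)]
  have hprod (q : Fin 4 → ℝ) : Complex.exp (((s * hopf (quat q) 0 : ℝ) : ℂ) * Complex.I) =
      ∏ i, Complex.exp (c i * (q i : ℂ) ^ 2) := by
    rw [← Complex.exp_sum, Fin.sum_univ_four, hopf_quat]
    congr 1
    simp [c]
    ring
  simp only [hprod]
  rw [integral_fintype_prod_eq_prod fun i (x : ℝ) => Complex.exp (c i * (x : ℂ) ^ 2),
    Fin.prod_univ_four]
  simp only [c, Matrix.cons_val]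
  rw [← sq, mul_assoc, ← sq, integral_cexp_mul_sq_gaussianReal_sq (by simp),
    integral_cexp_mul_sq_gaussianReal_sq (by simp), ← mul_inv, Complex.ofReal_inv]
  congr 1
  push_cast
  linear_combination -4 * (s : ℂ) ^ 2 * Complex.I_sq

theorem charFun_hopfLaw (t : E3) : charFun hopfLaw t = ((1 + 4 * ‖t‖ ^ 2)⁻¹ : ℝ) := by
  rcases eq_or_ne t 0 with rfl | ht
  · simp
  obtain ⟨u, rfl⟩ := hopf_surjective t
  have hu : ‖u‖ ≠ 0 := fun h => ht (norm_eq_zero.1 (by simp [norm_hopf, h]))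
  set w := ‖u‖⁻¹ • star u
  have hw : ‖w‖ = 1 := by simp [w, norm_smul, hu]
  have hphase (q : ℍ[ℝ]) : inner ℝ (hopf q) (hopf u) = ‖hopf u‖ * hopf (q * w) 0 := by
    have hwu : star u = ‖u‖ • w := by rw [smul_smul, mul_inv_cancel₀ hu, one_smul]
    rw [inner_hopf_hopf, norm_hopf, hwu, mul_smul_comm, hopf_smul, PiLp.smul_apply, smul_eq_mul]
  rw [charFun_apply, hopfLaw, integral_map continuous_hopf_quat.aemeasurable (by fun_prop)]
  simp only [hphase]
  rw [integral_quat_mul hw fun q => Complex.exp ((‖hopf u‖ * hopf q 0 : ℝ) * Complex.I),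
    integral_cexp_hopf_quat_zero]

theorem hopfLaw_eq_varianceGamma : hopfLaw = varianceGamma E3 2 1 := by
  have := isProbabilityMeasure_varianceGamma (V := E3) (σ := 2) two_pos one_pos
  refine Measure.ext_of_charFun (funext fun t => ?_)
  rw [charFun_hopfLaw, charFun_varianceGamma two_pos one_pos, Real.rpow_one, one_div]
  norm_num

theorem map_sum_pi_hopfLaw {ι : Type*} [Fintype ι] [Nonempty ι] :
    (Measure.pi fun _ : ι => hopfLaw).map (fun e => ∑ i, e i) =
      varianceGamma E3 2 (Fintype.card ι) := by
  have := isProbabilityMeasure_varianceGamma (V := E3) (σ := 2) (α := Fintype.card ι) two_pos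
    (by simp [Fintype.card_pos])
  refine Measure.ext_of_charFun ?_
  ext t
  rw [charFun_map_sum_pi_eq_prod, Finset.prod_apply, charFun_varianceGamma two_pos
    (by simp [Fintype.card_pos]), Finset.prod_const, charFun_hopfLaw, Real.rpow_natCast]
  norm_num

end HopfLaw

section Limits

theorem tendsto_of_le_liminf_of_tendsto_add {ι : Type*} {l : Filter ι} {a b : ι → ℝ≥0∞}
    {A B : ℝ≥0∞} (ha : A ≤ liminf a l) (hb : B ≤ liminf b l)
    (hab : Tendsto (fun i => a i + b i) l (𝓝 (A + B))) (hB : B ≠ ∞) : Tendsto a l (𝓝 A) := by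
  refine tendsto_order.2 ⟨fun A' hA' => eventually_lt_of_lt_liminf (hA'.trans_le ha),
    fun u hu => ?_⟩
  obtain ⟨c, hABc, hcu⟩ := exists_between (ENNReal.add_lt_add_right hB hu)
  have hbc : ∀ᶠ i in l, c - u ≤ b i := by
    rcases le_total c u with hc | hc
    · rw [tsub_eq_zero_of_le hc]
      exact Eventually.of_forall fun _ => zero_le
    · have hcB : c - u < B := ENNReal.sub_lt_of_lt_add hc (add_comm u B ▸ hcu)
      exact (eventually_lt_of_lt_liminf (hcB.trans_le hb)).mono fun i hi => hi.le
  filter_upwards [hbc, hab.eventually_lt_const hABc] with i hi hlt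
  by_contra! hua
  exact hlt.not_ge ((le_add_tsub (a := c) (b := u)).trans (add_le_add hua hi))

-- Pratt's lemma: Fatou for `F` gives the lower bound, and for `G - F` the upper one.
theorem tendsto_lintegral_of_le_of_tendsto_lintegral {X ι : Type*} [MeasurableSpace X]
    {μ : Measure X} {l : Filter ι} [l.IsCountablyGenerated] {F G : ι → X → ℝ≥0∞}
    {f g : X → ℝ≥0∞} (hF : ∀ i, Measurable (F i)) (hG : ∀ i, Measurable (G i))
    (hf : Measurable f) (hFG : ∀ i x, F i x ≤ G i x) (hfg : ∀ x, f x ≤ g x)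
    (hFf : ∀ᵐ x ∂μ, Tendsto (fun i => F i x) l (𝓝 (f x)))
    (hGg : ∀ᵐ x ∂μ, Tendsto (fun i => G i x) l (𝓝 (g x)))
    (hlim : Tendsto (fun i => ∫⁻ x, G i x ∂μ) l (𝓝 (∫⁻ x, g x ∂μ)))
    (hg : Measurable g) (hg_fin : ∫⁻ x, g x ∂μ ≠ ∞) :
    Tendsto (fun i => ∫⁻ x, F i x ∂μ) l (𝓝 (∫⁻ x, f x ∂μ)) := by
  rcases l.eq_or_neBot with rfl | _
  · exact tendsto_bot
  have hf_top : ∀ᵐ x ∂μ, f x ≠ ∞ := by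
    filter_upwards [ae_lt_top hg hg_fin] with x hx
    exact ((hfg x).trans_lt hx).ne
  refine tendsto_of_le_liminf_of_tendsto_add (b := fun i => ∫⁻ x, (G i x - F i x) ∂μ)
    (B := ∫⁻ x, (g x - f x) ∂μ) ?_ ?_ ?_
    ((lintegral_mono fun x => tsub_le_self).trans_lt hg_fin.lt_top).ne
  · refine le_trans (lintegral_mono_ae ?_) (lintegral_liminf_le hF)
    filter_upwards [hFf] with x hx
    exact hx.liminf_eq.ge
  · refine le_trans (lintegral_mono_ae ?_) (lintegral_liminf_le fun i => (hG i).sub (hF i))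
    filter_upwards [hFf, hGg, hf_top] with x hxF hxG hx
    exact (ENNReal.Tendsto.sub hxG hxF (.inr hx)).liminf_eq.ge
  · simp only [← lintegral_add_left (hF _), ← lintegral_add_left hf,
      add_tsub_cancel_of_le (hFG _ _), add_tsub_cancel_of_le (hfg _)]
    exact hlim

variable {V : Type*} [NormedAddCommGroup V] [NormedSpace ℝ V] [FiniteDimensional ℝ V]
  [MeasurableSpace V] [BorelSpace V] {ν : Measure V} [ν.IsAddHaarMeasure]

theorem tendsto_setLAverage_ball {φ : V → ℝ≥0∞} {x : V} (hφ : ContinuousAt φ x) :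
    Tendsto (fun ε : ℝ => ⨍⁻ y in Metric.ball x ε, φ y ∂ν) (𝓝[>] 0) (𝓝 (φ x)) := by
  have hconst (c : ℝ≥0∞) {ε : ℝ} (hε : 0 < ε) : ⨍⁻ _ in Metric.ball x ε, c ∂ν = c :=
    setLAverage_const (Metric.measure_ball_pos _ _ hε).ne' measure_ball_lt_top.ne c
  have hball {p : ℝ≥0∞ → Prop} (hp : ∀ᶠ y in 𝓝 x, p (φ y)) :
      ∀ᶠ ε in 𝓝[>] (0 : ℝ), ∀ y ∈ Metric.ball x ε, p (φ y) := by
    obtain ⟨δ, hδ, hb⟩ := Metric.eventually_nhds_iff_ball.1 hp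
    filter_upwards [Ioo_mem_nhdsGT hδ] with ε hε y hy
    exact hb y (Metric.ball_subset_ball hε.2.le hy)
  refine tendsto_order.2 ⟨fun c hc => ?_, fun c hc => ?_⟩
  · obtain ⟨d, hcd, hd⟩ := exists_between hc
    filter_upwards [hball (hφ.eventually_const_lt hd), self_mem_nhdsWithin] with ε hε hpos
    rw [← hconst d hpos] at hcd
    exact hcd.trans_le (laverage_mono_ae (ae_restrict_of_forall_mem measurableSet_ball
      fun y hy => le_of_lt (hε y hy)))
  · obtain ⟨d, hd, hdc⟩ := exists_between hc
    filter_upwards [hball (hφ.eventually_lt_const hd), self_mem_nhdsWithin] with ε hε hpos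
    rw [← hconst d hpos] at hdc
    exact (laverage_mono_ae (ae_restrict_of_forall_mem measurableSet_ball
      fun y hy => le_of_lt (hε y hy))).trans_lt hdc

end Limits

section Conditioning

/-- The law of the first component of a pair `(x, v)` distributed according to
`ρ.prod (ν.withDensity h)` and conditioned on the null event `S x + v = 0`, for any Haar measure
`ν`. The second component is then `-S x`. -/
def closureLaw {X V : Type*} [MeasurableSpace X] [Neg V] (ρ : Measure X)
    (h : V → ℝ≥0∞) (S : X → V) : Measure X :=
  (∫⁻ x, h (-S x) ∂ρ)⁻¹ • ρ.withDensity fun x => h (-S x)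

theorem isProbabilityMeasure_closureLaw {X V : Type*} [MeasurableSpace X] [Neg V]
    {ρ : Measure X} {h : V → ℝ≥0∞} {S : X → V}
    (hZ_zero : ∫⁻ x, h (-S x) ∂ρ ≠ 0) (hZ_top : ∫⁻ x, h (-S x) ∂ρ ≠ ∞) :
    IsProbabilityMeasure (closureLaw ρ h S) := by
  refine ⟨?_⟩
  rw [closureLaw, Measure.smul_apply, withDensity_apply _ MeasurableSet.univ,
    Measure.restrict_univ, smul_eq_mul, ENNReal.inv_mul_cancel hZ_zero hZ_top]

variable {X V : Type*} [MeasurableSpace X] [NormedAddCommGroup V] [MeasurableSpace V]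
  [BorelSpace V] {ρ : Measure X} {ν : Measure V}

theorem setLIntegral_prod_withDensity_preimage_add [SecondCountableTopology V] [SFinite ρ]
    [SFinite ν] [ν.IsAddRightInvariant] {S : X → V} (hS : Measurable S) {h : V → ℝ≥0∞}
    (hh : Measurable h) {f : X × V → ℝ≥0∞} (hf : Measurable f)
    {B : Set V} (hB : MeasurableSet B) :
    ∫⁻ p in {p | S p.1 + p.2 ∈ B}, f p ∂(ρ.prod (ν.withDensity h)) =
      ∫⁻ s in B, ∫⁻ x, f (x, s - S x) * h (s - S x) ∂ρ ∂ν := by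
  have hset : MeasurableSet {p : X × V | S p.1 + p.2 ∈ B} :=
    ((hS.comp measurable_fst).add measurable_snd) hB
  have hF := hf.indicator hset
  have hsub : Measurable fun p : V × X => p.1 - S p.2 :=
    measurable_fst.sub (hS.comp measurable_snd)
  have hG : Measurable fun p : V × X => f (p.2, p.1 - S p.2) * h (p.1 - S p.2) :=
    (hf.comp (measurable_snd.prodMk hsub)).mul (hh.comp hsub)
  rw [lintegral_lintegral_swap (μ := ν.restrict B) hG.aemeasurable, ← lintegral_indicator hset,
    lintegral_prod _ hF.aemeasurable]
  refine lintegral_congr fun x => ?_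
  have hFx : Measurable fun y => {p | S p.1 + p.2 ∈ B}.indicator f (x, y) :=
    hF.comp measurable_prodMk_left
  rw [lintegral_withDensity_eq_lintegral_mul _ hh hFx,
    ← lintegral_sub_right_eq_self _ (S x), ← lintegral_indicator hB]
  refine lintegral_congr fun s => ?_
  by_cases hs : s ∈ B <;> simp [Set.indicator, hs, mul_comm]

theorem continuousAt_lintegral_mul_sub {S : X → V} (hS : Measurable S)
    {h : V → ℝ≥0∞} (hh : Continuous h) {f : X × V → ℝ≥0∞} (hf : Measurable f)
    {C : ℝ≥0∞} (hC : C ≠ ∞) (hfC : ∀ p, f p ≤ C) (hf_cont : ∀ x, Continuous fun v => f (x, v))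
    {s : V} (hZ : ContinuousAt (fun s => ∫⁻ x, h (s - S x) ∂ρ) s)
    (hZs : ∫⁻ x, h (s - S x) ∂ρ ≠ ∞) :
    ContinuousAt (fun s => ∫⁻ x, f (x, s - S x) * h (s - S x) ∂ρ) s := by
  have hsub (s : V) : Measurable fun x => s - S x := hS.const_sub s
  have hmeas (s : V) : Measurable fun x => h (s - S x) := hh.measurable.comp (hsub s)
  have hcont (x : X) : Continuous fun s => h (s - S x) := hh.comp (continuous_sub_right _)
  refine tendsto_lintegral_of_le_of_tendsto_lintegral (G := fun s x => C * h (s - S x))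
    (g := fun x => C * h (s - S x))
    (fun s => (hf.comp (measurable_id.prodMk (hsub s))).mul (hmeas s))
    (fun s => (hmeas s).const_mul C) ((hf.comp (measurable_id.prodMk (hsub s))).mul (hmeas s))
    (fun s x => by gcongr; exact hfC _) (fun x => by gcongr; exact hfC _) ?_ ?_ ?_
    ((hmeas s).const_mul C) ?_
  · filter_upwards [ae_lt_top (hmeas s) hZs] with x hx
    exact ENNReal.Tendsto.mul ((hf_cont x).comp (continuous_sub_right (S x))).continuousAt
      (.inr hx.ne) (hcont x).continuousAt (.inr ((hfC _).trans_lt hC.lt_top).ne)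
  · exact ae_of_all _ fun x => ENNReal.Tendsto.const_mul (hcont x).continuousAt (.inr hC)
  · simp only [lintegral_const_mul C (hmeas _)]
    exact ENNReal.Tendsto.const_mul hZ (.inr hC)
  · rw [lintegral_const_mul C (hmeas s)]
    exact ENNReal.mul_ne_top hC hZs

theorem lintegral_closureLaw {S : X → V} (hS : Measurable S) {h : V → ℝ≥0∞} (hh : Measurable h)
    {f : X → ℝ≥0∞} (hf : Measurable f) :
    ∫⁻ x, f x ∂closureLaw ρ h S = (∫⁻ x, f x * h (-S x) ∂ρ) / ∫⁻ x, h (-S x) ∂ρ := by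
  have hh_neg : Measurable fun x => h (-S x) := hh.comp hS.neg
  rw [closureLaw, lintegral_smul_measure, lintegral_withDensity_eq_lintegral_mul _ hh_neg hf,
    smul_eq_mul, ← ENNReal.div_eq_inv_mul]
  simp only [Pi.mul_apply, mul_comm]

section Limit

variable [NormedSpace ℝ V] [FiniteDimensional ℝ V] [SFinite ρ] [ν.IsAddHaarMeasure]
  {Ω : Type*} [MeasurableSpace Ω] {P : Measure Ω} {π : Ω → X × V} {S : X → V} {h : V → ℝ≥0∞}

theorem tendsto_lintegral_cond_norm_lt (hh : Continuous h)
    (hπ : MeasurePreserving π P (ρ.prod (ν.withDensity h))) (hS : Measurable S)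
    (hZ : ContinuousAt (fun s => ∫⁻ x, h (s - S x) ∂ρ) 0)
    (hZ_zero : ∫⁻ x, h (-S x) ∂ρ ≠ 0) (hZ_top : ∫⁻ x, h (-S x) ∂ρ ≠ ∞)
    {f : X × V → ℝ≥0∞} (hf : Measurable f) {C : ℝ≥0∞} (hC : C ≠ ∞) (hfC : ∀ p, f p ≤ C)
    (hf_cont : ∀ x, Continuous fun v => f (x, v)) :
    Tendsto (fun ε : ℝ => ∫⁻ ω, f (π ω) ∂P[|{ω | ‖S (π ω).1 + (π ω).2‖ < ε}]) (𝓝[>] 0)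
      (𝓝 (∫⁻ x, f (x, -S x) ∂closureLaw ρ h S)) := by
  have htube {f : X × V → ℝ≥0∞} (hf : Measurable f) (ε : ℝ) :
      ∫⁻ ω in {ω | ‖S (π ω).1 + (π ω).2‖ < ε}, f (π ω) ∂P =
        ∫⁻ s in Metric.ball 0 ε, ∫⁻ x, f (x, s - S x) * h (s - S x) ∂ρ ∂ν := by
    have hset : MeasurableSet {p : X × V | S p.1 + p.2 ∈ Metric.ball 0 ε} :=
      ((hS.comp measurable_fst).add measurable_snd) measurableSet_ball
    rw [← setLIntegral_prod_withDensity_preimage_add hS hh.measurable hf measurableSet_ball,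
      ← hπ.setLIntegral_comp_preimage hset hf]
    simp only [preimage_ofPred_eq, mem_ball_zero_iff]
  have hnum := tendsto_setLAverage_ball (ν := ν)
    (continuousAt_lintegral_mul_sub hS hh hf hC hfC hf_cont hZ (by simpa only [zero_sub]))
  have hden := tendsto_setLAverage_ball (ν := ν) hZ
  simp only [zero_sub] at hnum hden
  have hf_graph : Measurable fun x => f (x, -S x) := hf.comp (measurable_id.prodMk hS.neg)
  rw [lintegral_closureLaw hS hh.measurable hf_graph]
  refine (ENNReal.Tendsto.div hnum (.inr hZ_zero) hden (.inl hZ_top)).congr' ?_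
  filter_upwards [self_mem_nhdsWithin] with ε (hε : 0 < ε)
  have hP : P {ω | ‖S (π ω).1 + (π ω).2‖ < ε} =
      ∫⁻ s in Metric.ball 0 ε, ∫⁻ x, h (s - S x) ∂ρ ∂ν := by
    simpa only [Pi.one_apply, one_mul, setLIntegral_one] using htube measurable_one ε
  rw [ProbabilityTheory.cond, lintegral_smul_measure, htube hf, hP, setLAverage_eq,
    setLAverage_eq, smul_eq_mul, ENNReal.div_eq_inv_mul (b := ν _),
    ENNReal.div_eq_inv_mul (b := ν _), ENNReal.mul_div_mul_left _ _
      (ENNReal.inv_ne_zero.2 measure_ball_lt_top.ne)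
      (ENNReal.inv_ne_top.2 (Metric.measure_ball_pos ν _ hε).ne'), ENNReal.div_eq_inv_mul]

theorem tendsto_integral_cond_norm_lt [TopologicalSpace X] [OpensMeasurableSpace X]
    (hh : Continuous h) (hπ : MeasurePreserving π P (ρ.prod (ν.withDensity h)))
    (hS : Measurable S) (hZ : ContinuousAt (fun s => ∫⁻ x, h (s - S x) ∂ρ) 0)
    (hZ_zero : ∫⁻ x, h (-S x) ∂ρ ≠ 0) (hZ_top : ∫⁻ x, h (-S x) ∂ρ ≠ ∞) (f : X × V →ᵇ ℝ) :
    Tendsto (fun ε : ℝ => ∫ ω, f (π ω) ∂P[|{ω | ‖S (π ω).1 + (π ω).2‖ < ε}]) (𝓝[>] 0)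
      (𝓝 (∫ x, f (x, -S x) ∂closureLaw ρ h S)) := by
  have := isProbabilityMeasure_closureLaw hZ_zero hZ_top
  have hgraph : Measurable fun x => (x, -S x) := measurable_id.prodMk hS.neg
  let condLaw (ε : ℝ) : FiniteMeasure (X × V) :=
    ⟨P[|{ω | ‖S (π ω).1 + (π ω).2‖ < ε}].map π, inferInstance⟩
  let limitLaw : FiniteMeasure (X × V) := ⟨(closureLaw ρ h S).map fun x => (x, -S x), inferInstance⟩
  have hlim : Tendsto condLaw (𝓝[>] 0) (𝓝 limitLaw) := by
    refine FiniteMeasure.tendsto_iff_forall_lintegral_tendsto.2 fun g => ?_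
    have hg : Measurable fun p => (g p : ℝ≥0∞) := g.continuous.measurable.coe_nnreal_ennreal
    simp only [condLaw, limitLaw, FiniteMeasure.toMeasure_mk, lintegral_map hg hπ.measurable,
      lintegral_map hg hgraph]
    exact tendsto_lintegral_cond_norm_lt hh hπ hS hZ hZ_zero hZ_top hg ENNReal.coe_ne_top
      (fun p => ENNReal.coe_le_coe.2 (BoundedContinuousFunction.NNReal.upper_bound g p))
      fun x => ENNReal.continuous_coe.comp (g.continuous.comp (Continuous.prodMk_right x))
  have hint := FiniteMeasure.tendsto_iff_forall_integral_tendsto.1 hlim f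
  simpa only [condLaw, limitLaw, FiniteMeasure.toMeasure_mk,
    integral_map hπ.measurable.aemeasurable f.continuous.aestronglyMeasurable,
    integral_map hgraph.aemeasurable f.continuous.aestronglyMeasurable] using hint

end Limit

end Conditioning

section VarianceGammaClosure

variable {X V : Type*} [MeasurableSpace X] [NormedAddCommGroup V] [InnerProductSpace ℝ V]
  [FiniteDimensional ℝ V] [MeasurableSpace V] [BorelSpace V] {ρ : Measure X} {S : X → V}
  {σ α β : ℝ}

theorem lintegral_varianceGammaPDF_sub_of_map_eq (hσ : 0 < σ)
    (hα : 0 < α - Module.finrank ℝ V / 2) (hβ : 0 < β) (hS : Measurable S)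
    (hρ : ρ.map S = varianceGamma V σ α) (s : V) :
    ∫⁻ x, varianceGammaPDF (Module.finrank ℝ V) σ β ‖s - S x‖ ∂ρ =
      varianceGammaPDF (Module.finrank ℝ V) σ (α + β) ‖s‖ := by
  have hmeas : Measurable fun y : V => varianceGammaPDF (Module.finrank ℝ V) σ β ‖s - y‖ :=
    (measurable_varianceGammaPDF_norm σ β).comp (measurable_const_sub s)
  rw [← lintegral_map hmeas hS, hρ, lintegral_varianceGammaPDF_sub_comm,
    lintegral_varianceGammaPDF_sub hσ hβ hα, add_comm]

theorem lintegral_varianceGammaPDF_neg_of_map_eq (hσ : 0 < σ)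
    (hα : 0 < α - Module.finrank ℝ V / 2) (hβ : 0 < β) (hS : Measurable S)
    (hρ : ρ.map S = varianceGamma V σ α) :
    ∫⁻ x, varianceGammaPDF (Module.finrank ℝ V) σ β ‖-S x‖ ∂ρ =
      varianceGammaPDF (Module.finrank ℝ V) σ (α + β) 0 := by
  simpa only [zero_sub, norm_zero] using
    lintegral_varianceGammaPDF_sub_of_map_eq hσ hα hβ hS hρ 0

theorem varianceGammaPDF_zero_ne_zero {d : ℕ} (hσ : 0 < σ) (hα : 0 < α - d / 2) :
    varianceGammaPDF d σ α 0 ≠ 0 := by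
  have hα' : 0 < α := by linarith [show (0 : ℝ) ≤ d / 2 by positivity]
  rw [varianceGammaPDF_zero hσ hα, ENNReal.ofReal_ne_zero_iff]
  have := Real.Gamma_pos_of_pos hα
  have := Real.Gamma_pos_of_pos hα'
  positivity

theorem varianceGammaPDF_zero_ne_top {d : ℕ} (hσ : 0 < σ) (hα : 0 < α - d / 2) :
    varianceGammaPDF d σ α 0 ≠ ∞ := by
  rw [varianceGammaPDF_zero hσ hα]
  exact ENNReal.ofReal_ne_top

theorem isProbabilityMeasure_closureLaw_varianceGamma (hσ : 0 < σ)
    (hα : 0 < α - Module.finrank ℝ V / 2) (hβ : 0 < β) (hS : Measurable S)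
    (hρ : ρ.map S = varianceGamma V σ α) :
    IsProbabilityMeasure
      (closureLaw ρ (fun v => varianceGammaPDF (Module.finrank ℝ V) σ β ‖v‖) S) := by
  have hαβ : 0 < α + β - Module.finrank ℝ V / 2 := by linarith
  apply isProbabilityMeasure_closureLaw <;>
    rw [lintegral_varianceGammaPDF_neg_of_map_eq hσ hα hβ hS hρ]
  exacts [varianceGammaPDF_zero_ne_zero hσ hαβ, varianceGammaPDF_zero_ne_top hσ hαβ]

theorem tendsto_integral_cond_varianceGamma [SFinite ρ] [TopologicalSpace X]
    [OpensMeasurableSpace X] {Ω : Type*} [MeasurableSpace Ω] {P : Measure Ω} {π : Ω → X × V}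
    (hσ : 0 < σ) (hα : 0 < α - Module.finrank ℝ V / 2) (hβ : 0 < β)
    (hπ : MeasurePreserving π P (ρ.prod (varianceGamma V σ β))) (hS : Measurable S)
    (hρ : ρ.map S = varianceGamma V σ α) (f : X × V →ᵇ ℝ) :
    Tendsto (fun ε : ℝ => ∫ ω, f (π ω) ∂P[|{ω | ‖S (π ω).1 + (π ω).2‖ < ε}]) (𝓝[>] 0)
      (𝓝 (∫ x, f (x, -S x)
        ∂closureLaw ρ (fun v => varianceGammaPDF (Module.finrank ℝ V) σ β ‖v‖) S)) := by
  have hα' : 0 < α := by linarith [show (0 : ℝ) ≤ Module.finrank ℝ V / 2 by positivity]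
  have hαβ : 0 < α + β - Module.finrank ℝ V / 2 := by linarith
  have hZ := lintegral_varianceGammaPDF_neg_of_map_eq hσ hα hβ hS hρ
  have hcont {γ : ℝ} (hγ : 0 < γ) :
      Continuous fun v : V => varianceGammaPDF (Module.finrank ℝ V) σ γ ‖v‖ :=
    (continuous_varianceGammaPDF hσ hγ).comp continuous_norm
  refine tendsto_integral_cond_norm_lt (hcont hβ) hπ hS ?_ ?_ ?_ f
  · simp only [lintegral_varianceGammaPDF_sub_of_map_eq hσ hα hβ hS hρ]
    exact (hcont (add_pos hα' hβ)).continuousAt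
  · exact hZ ▸ varianceGammaPDF_zero_ne_zero hσ hαβ
  · exact hZ ▸ varianceGammaPDF_zero_ne_top hσ hαβ

end VarianceGammaClosure

section PolygonMeasure

theorem sub_finrank_E3_pos {m : ℕ} (hm : 1 < m) : (0 : ℝ) < m - Module.finrank ℝ E3 / 2 := by
  have hm' : (2 : ℝ) ≤ m := mod_cast hm
  rw [finrank_euclideanSpace_fin]
  push_cast
  linarith

instance (n : ℕ) : IsProbabilityMeasure (hopfGaussianArm n) := by
  rw [hopfGaussianArm_eq_pi]
  infer_instance

theorem measurePreserving_tail_head (N : ℕ) :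
    MeasurePreserving (fun e : Arm (N + 1) => (Fin.tail e, e 0)) (hopfGaussianArm (N + 1))
      ((hopfGaussianArm N).prod (varianceGamma E3 2 1)) := by
  rw [hopfGaussianArm_eq_pi, hopfGaussianArm_eq_pi, ← hopfLaw_eq_varianceGamma]
  convert Measure.measurePreserving_swap.comp
    (measurePreserving_piFinSuccAbove (fun _ : Fin (N + 1) => hopfLaw) 0) using 1
  rfl

theorem map_sum_hopfGaussianArm {N : ℕ} (hN : 0 < N) :
    (hopfGaussianArm N).map (fun e => ∑ i, e i) = varianceGamma E3 2 N := by
  have := Fin.pos_iff_nonempty.1 hN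
  rw [hopfGaussianArm_eq_pi, map_sum_pi_hopfLaw, Fintype.card_fin]

/-- The closed polygon with last `N` edges `e`. -/
def closeArm {N : ℕ} (e : Arm N) : closedPolygons (N + 1) :=
  ⟨Fin.cons (-∑ i, e i) e, by simp [closedPolygons, Fin.sum_univ_succ]⟩

theorem measurable_closeArm (N : ℕ) : Measurable (closeArm (N := N)) := by
  have hcons : Continuous fun e : Arm N => (Fin.cons (-∑ i, e i) e : Arm (N + 1)) := by fun_prop
  exact hcons.measurable.subtype_mk

/-- The law of the polygon obtained by closing the last `N` edges of a Hopf-Gaussian arm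
conditioned on closure. -/
def polygonMeasure (N : ℕ) : Measure (closedPolygons (N + 1)) :=
  (closureLaw (hopfGaussianArm N) (fun v => varianceGammaPDF (Module.finrank ℝ E3) 2 1 ‖v‖)
    fun e => ∑ i, e i).map closeArm

theorem isHopfGaussianPolygonMeasure_polygonMeasure {N : ℕ} (hN : 1 < N) :
    IsHopfGaussianPolygonMeasure (N + 1) (polygonMeasure N) := by
  have hsum : Measurable fun e : Arm N => ∑ i, e i := by fun_prop
  have hlaw := map_sum_hopfGaussianArm (zero_lt_one.trans hN)
  have hα := sub_finrank_E3_pos hN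
  have := isProbabilityMeasure_closureLaw_varianceGamma two_pos hα one_pos hsum hlaw
  refine ⟨Measure.isProbabilityMeasure_map (measurable_closeArm N).aemeasurable, fun f => ?_⟩
  let cons : C(Arm N × E3, Arm (N + 1)) := ⟨fun p => Fin.cons p.2 p.1, by fun_prop⟩
  have hlim := tendsto_integral_cond_varianceGamma two_pos hα one_pos
    (measurePreserving_tail_head N) hsum hlaw (f.compContinuous cons)
  have hf : Continuous fun p : closedPolygons (N + 1) => f p := by fun_prop
  rw [polygonMeasure, integral_map (measurable_closeArm N).aemeasurable hf.aestronglyMeasurable]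
  simpa [cons, closeArm, Fin.sum_univ_succ, Fin.tail, add_comm] using hlim

theorem measurableSet_closedPolygons (n : ℕ) : MeasurableSet (closedPolygons n) :=
  (isClosed_eq (by fun_prop) continuous_const).measurableSet

theorem IsHopfGaussianPolygonMeasure.unique {n : ℕ} {μ ν : Measure (closedPolygons n)}
    (hμ : IsHopfGaussianPolygonMeasure n μ) (hν : IsHopfGaussianPolygonMeasure n ν) : μ = ν := by
  have := hμ.1
  have := hν.1
  have hval : Measurable (Subtype.val : closedPolygons n → Arm n) := measurable_subtype_coe
  have hmap : μ.map Subtype.val = ν.map Subtype.val := by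
    refine ext_of_forall_integral_eq_of_IsFiniteMeasure fun f => ?_
    rw [integral_map hval.aemeasurable f.continuous.aestronglyMeasurable,
      integral_map hval.aemeasurable f.continuous.aestronglyMeasurable]
    exact tendsto_nhds_unique (hμ.2 f) (hν.2 f)
  have hemb := MeasurableEmbedding.subtype_coe (measurableSet_closedPolygons n)
  rw [← hemb.comap_map μ, hmap, hemb.comap_map]

theorem existsUnique_isHopfGaussianPolygonMeasure {n : ℕ} (hn : 2 < n) :
    ∃! μ : Measure (closedPolygons n), IsHopfGaussianPolygonMeasure n μ := by
  obtain ⟨N, rfl⟩ := Nat.exists_eq_add_one.2 (Nat.zero_lt_of_lt hn)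
  exact ⟨polygonMeasure N, isHopfGaussianPolygonMeasure_polygonMeasure (by omega),
    fun _ hμ => hμ.unique (isHopfGaussianPolygonMeasure_polygonMeasure (by omega))⟩

end PolygonMeasure

section PairLaw

theorem map_add_prod_hopfLaw :
    (hopfLaw.prod hopfLaw).map (fun p => p.1 + p.2) = varianceGamma E3 2 (2 : ℕ) := by
  rw [hopfLaw_eq_varianceGamma, ← Measure.conv, varianceGamma_conv two_pos one_pos one_pos]
  norm_num

theorem measurePreserving_pair_sum_rest {M : ℕ} (hM : 0 < M) {i j : Fin (M + 2)} (hij : i ≠ j) :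
    MeasurePreserving (fun e : Arm (M + 2) => ((e i, e j), ∑ k, e k - (e i + e j)))
      (hopfGaussianArm (M + 2)) ((hopfLaw.prod hopfLaw).prod (varianceGamma E3 2 M)) := by
  have := isProbabilityMeasure_varianceGamma (V := E3) (σ := 2) (α := M) two_pos (mod_cast hM)
  obtain ⟨j', rfl⟩ := Fin.exists_succAbove_eq hij.symm
  have hi := measurePreserving_piFinSuccAbove (fun _ : Fin (M + 2) => hopfLaw) i
  have hj := measurePreserving_piFinSuccAbove (fun _ : Fin (M + 1) => hopfLaw) j'
  have hrest : MeasurePreserving (fun e : Arm M => ∑ k, e k) (Measure.pi fun _ => hopfLaw)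
      (varianceGamma E3 2 M) :=
    ⟨by fun_prop, hopfGaussianArm_eq_pi M ▸ map_sum_hopfGaussianArm hM⟩
  have hsplit := (MeasurePreserving.id hopfLaw).prod
    (((MeasurePreserving.id hopfLaw).prod hrest).comp hj)
  rw [hopfGaussianArm_eq_pi]
  convert ((measurePreserving_prodAssoc hopfLaw hopfLaw _).symm.comp hsplit).comp hi using 1
  ext e : 1
  rw [Fin.sum_univ_succAbove _ i, Fin.sum_univ_succAbove _ j']
  simp [MeasurableEquiv.piFinSuccAbove, Fin.insertNthEquiv, MeasurableEquiv.prodAssoc,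
    Fin.removeNth, add_sub_add_left_eq_sub]

theorem IsHopfGaussianPolygonMeasure.map_pair_eq_closureLaw {M : ℕ} (hM : 0 < M)
    {i j : Fin (M + 2)} (hij : i ≠ j) {μ : Measure (closedPolygons (M + 2))}
    (hμ : IsHopfGaussianPolygonMeasure (M + 2) μ) :
    μ.map (fun p => (p.1 i, p.1 j)) = closureLaw (hopfLaw.prod hopfLaw)
      (fun v => varianceGammaPDF (Module.finrank ℝ E3) 2 M ‖v‖) fun p => p.1 + p.2 := by
  have := hμ.1
  have hM' : (0 : ℝ) < M := mod_cast hM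
  have hα := sub_finrank_E3_pos one_lt_two
  have hadd : Measurable fun p : E3 × E3 => p.1 + p.2 := by fun_prop
  have := isProbabilityMeasure_closureLaw_varianceGamma two_pos hα hM' hadd map_add_prod_hopfLaw
  have hpair : Measurable fun p : closedPolygons (M + 2) => (p.1 i, p.1 j) :=
    ((measurable_pi_apply i).comp measurable_subtype_coe).prodMk
      ((measurable_pi_apply j).comp measurable_subtype_coe)
  refine ext_of_forall_integral_eq_of_IsFiniteMeasure fun g => ?_
  rw [integral_map hpair.aemeasurable g.continuous.aestronglyMeasurable]
  refine tendsto_nhds_unique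
    (hμ.2 (g.compContinuous ⟨fun e : Arm (M + 2) => (e i, e j), by fun_prop⟩)) ?_
  simpa using tendsto_integral_cond_varianceGamma two_pos hα hM'
    (measurePreserving_pair_sum_rest hM hij) hadd map_add_prod_hopfLaw
    (g.compContinuous ⟨Prod.fst, continuous_fst⟩)

end PairLaw

section SphericalCoordinates

open InnerProductGeometry Module

/-- The surface area of the unit sphere in `ℝᵈ`, normalising spherical coordinates. -/
def sphereArea (d : ℕ) : ℝ≥0∞ :=
  d * volume (Metric.ball (0 : EuclideanSpace ℝ (Fin d)) 1)

theorem sphereArea_two : sphereArea 2 = ENNReal.ofReal (2 * Real.pi) := by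
  rw [sphereArea, EuclideanSpace.volume_ball_fin_two, ENNReal.ofReal_mul two_pos.le]
  simp [ENNReal.ofReal, Real.toNNReal_of_nonneg Real.pi_pos.le]

theorem sphereArea_three : sphereArea 3 = ENNReal.ofReal (4 * Real.pi) := by
  rw [sphereArea, EuclideanSpace.volume_ball_fin_three, ← ENNReal.ofReal_natCast,
    ENNReal.ofReal_one, one_pow, one_mul, ← ENNReal.ofReal_mul (by positivity)]
  congr 1
  push_cast
  ring

variable {V : Type*} [NormedAddCommGroup V] [InnerProductSpace ℝ V]

theorem norm_add_eq_chord (x y : V) : ‖x + y‖ = chord ‖x‖ ‖y‖ (angle x y) := by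
  rw [chord, ← Real.sqrt_sq (norm_nonneg (x + y)), norm_add_sq_real,
    ← cos_angle_mul_norm_mul_norm x y]
  congr 1
  ring

theorem norm_smul_add_of_mem_orthogonal {u w : V} (hu : ‖u‖ = 1) (hw : w ∈ (ℝ ∙ u)ᗮ) (c : ℝ) :
    ‖c • u + w‖ = √(c ^ 2 + ‖w‖ ^ 2) := by
  have hperp : inner ℝ u w = 0 := Submodule.mem_orthogonal_singleton_iff_inner_right.1 hw
  rw [← Real.sqrt_sq (norm_nonneg (c • u + w)), norm_add_sq_real, real_inner_smul_left, hperp,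
    norm_smul, hu, mul_one, mul_zero, mul_zero, add_zero, Real.norm_eq_abs, sq_abs]

theorem angle_smul_add_of_mem_orthogonal {u w : V} (hu : ‖u‖ = 1) (hw : w ∈ (ℝ ∙ u)ᗮ) (c : ℝ) :
    angle u (c • u + w) = Real.arccos (c / √(c ^ 2 + ‖w‖ ^ 2)) := by
  have hperp : inner ℝ u w = 0 := Submodule.mem_orthogonal_singleton_iff_inner_right.1 hw
  rw [angle, norm_smul_add_of_mem_orthogonal hu hw, inner_add_right, real_inner_smul_right,
    real_inner_self_eq_norm_sq, hperp, hu, one_pow, mul_one, add_zero, one_mul]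

variable [FiniteDimensional ℝ V] [MeasurableSpace V] [BorelSpace V] {k : ℕ}

@[fun_prop]
theorem measurable_angle : Measurable fun p : V × V => angle p.1 p.2 := by
  unfold angle
  fun_prop

theorem toSphere_univ_eq_sphereArea :
    (volume : Measure V).toSphere univ = sphereArea (finrank ℝ V) := by
  have hball := (stdOrthonormalBasis ℝ V).measurePreserving_repr.measure_preimage
    (Metric.isOpen_ball (x := 0) (ε := 1)).measurableSet.nullMeasurableSet
  rw [Measure.toSphere_apply_univ, sphereArea, ← hball, LinearIsometryEquiv.preimage_ball, map_zero]

theorem lintegral_comp_norm (hV : finrank ℝ V = k + 1) {f : ℝ → ℝ≥0∞} (hf : Measurable f) :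
    ∫⁻ x : V, f ‖x‖ =
      sphereArea (k + 1) * ∫⁻ r in Ioi (0 : ℝ), ENNReal.ofReal (r ^ k) * f r := by
  have : Nontrivial V := nontrivial_of_finrank_pos (R := ℝ) (by omega)
  calc ∫⁻ x : V, f ‖x‖
    _ = ∫⁻ x : ({0}ᶜ : Set V), f ‖x.1‖ ∂(volume.comap Subtype.val) := by
        rw [lintegral_subtype_comap (measurableSet_singleton _).compl fun x => f ‖x‖,
          restrict_compl_singleton]
    _ = ∫⁻ p, f p.2 ∂(volume.toSphere.prod (.volumeIoiPow (finrank ℝ V - 1))) := by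
        simpa using (volume : Measure V).measurePreserving_homeomorphUnitSphereProd.lintegral_comp
          (f := fun p => f p.2) (by fun_prop)
    _ = sphereArea (k + 1) * ∫⁻ r : Ioi (0 : ℝ), f r ∂(.volumeIoiPow k) := by
        rw [lintegral_prod _ (by fun_prop)]
        simp only [lintegral_const]
        rw [toSphere_univ_eq_sphereArea, hV,
          Nat.add_sub_cancel, mul_comm]
    _ = sphereArea (k + 1) * ∫⁻ r in Ioi (0 : ℝ), ENNReal.ofReal (r ^ k) * f r := by
        rw [Measure.volumeIoiPow, lintegral_withDensity_eq_lintegral_mul _ (by fun_prop)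
          (by fun_prop), ← lintegral_subtype_comap measurableSet_Ioi]
        simp only [Pi.mul_apply]

theorem measurePreserving_smul_add_orthogonal {u : V} (hu : ‖u‖ = 1) :
    MeasurePreserving fun p : ℝ × (ℝ ∙ u)ᗮ => p.1 • u + (p.2 : V) :=
  (((ℝ ∙ u).orthogonalDecomposition.symm.measurePreserving.comp
    (WithLp.volume_preserving_toLp _ _)).comp
    ((LinearIsometryEquiv.toSpanUnitSingleton u hu).measurePreserving.prod
      (MeasurePreserving.id volume)) :)

theorem lintegral_halfPlane_eq_lintegral_polar (f : ℝ × ℝ → ℝ≥0∞) :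
    ∫⁻ p in univ ×ˢ Ioi (0 : ℝ), f p =
      ∫⁻ p in Ioi (0 : ℝ) ×ˢ Ioo 0 Real.pi,
        ENNReal.ofReal p.1 * f (p.1 * Real.cos p.2, p.1 * Real.sin p.2) := by
  have hupper : MeasurableSet (univ ×ˢ Ioi (0 : ℝ) : Set (ℝ × ℝ)) :=
    MeasurableSet.univ.prod measurableSet_Ioi
  have hstrip : MeasurableSet (Ioi (0 : ℝ) ×ˢ Ioo 0 Real.pi) := by measurability
  have hsub : Ioi (0 : ℝ) ×ˢ Ioo 0 Real.pi ⊆ polarCoord.target :=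
    prod_mono_right (Ioo_subset_Ioo_left (by linarith [Real.pi_pos]))
  rw [← lintegral_indicator hupper, ← lintegral_comp_polarCoord_symm, ← inter_eq_left.2 hsub,
    ← setLIntegral_indicator hstrip]
  refine setLIntegral_congr_fun polarCoord.open_target.measurableSet fun p hp => ?_
  obtain ⟨hr, hθ⟩ : 0 < p.1 ∧ p.2 ∈ Ioo (-Real.pi) Real.pi := hp
  have hmem : polarCoord.symm p ∈ univ ×ˢ Ioi (0 : ℝ) ↔ p ∈ Ioi (0 : ℝ) ×ˢ Ioo 0 Real.pi := by
    refine ⟨fun h => ⟨hr, ?_, hθ.2⟩, fun h => ⟨mem_univ _, ?_⟩⟩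
    · by_contra! hneg
      exact (mul_nonpos_of_nonneg_of_nonpos hr.le
        (Real.sin_nonpos_of_nonpos_of_neg_pi_le hneg hθ.1.le)).not_gt h.2
    · exact mul_pos hr (Real.sin_pos_of_mem_Ioo h.2)
  by_cases hp : p ∈ Ioi (0 : ℝ) ×ˢ Ioo 0 Real.pi
  · rw [indicator_of_mem hp, indicator_of_mem (hmem.2 hp), smul_eq_mul, polarCoord_symm_apply]
  · rw [indicator_of_notMem hp, indicator_of_notMem (mt hmem.1 hp), smul_zero]

theorem lintegral_comp_cylindrical (hV : finrank ℝ V = k + 2) {u : V} (hu : ‖u‖ = 1)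
    {g : ℝ × ℝ → ℝ≥0∞} (hg : Measurable g) :
    ∫⁻ p : ℝ × (ℝ ∙ u)ᗮ, g (p.1, ‖p.2‖) =
      sphereArea (k + 1) * ∫⁻ q in univ ×ˢ Ioi (0 : ℝ), ENNReal.ofReal (q.2 ^ k) * g q := by
  have : Fact (finrank ℝ V = k + 1 + 1) := ⟨hV⟩
  have hrank : finrank ℝ (ℝ ∙ u)ᗮ = k + 1 :=
    Submodule.finrank_orthogonal_span_singleton (norm_ne_zero_iff.1 (hu ▸ one_ne_zero))
  have hradial (c : ℝ) : ∫⁻ w : (ℝ ∙ u)ᗮ, g (c, ‖w‖) =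
      sphereArea (k + 1) * ∫⁻ ρ in Ioi (0 : ℝ), ENNReal.ofReal (ρ ^ k) * g (c, ρ) :=
    lintegral_comp_norm hrank (f := fun ρ => g (c, ρ)) (by fun_prop)
  rw [Measure.volume_eq_prod, lintegral_prod _ (by fun_prop), lintegral_congr hradial,
    lintegral_const_mul _ (by fun_prop), Measure.volume_eq_prod, ← Measure.prod_restrict,
    lintegral_prod _ (by fun_prop), Measure.restrict_univ]

theorem lintegral_comp_norm_angle (hV : finrank ℝ V = k + 2) {u : V} (hu : u ≠ 0)
    {f : ℝ × ℝ → ℝ≥0∞} (hf : Measurable f) :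
    ∫⁻ y : V, f (‖y‖, angle u y) =
      sphereArea (k + 1) * ∫⁻ p in Ioi (0 : ℝ) ×ˢ Ioo 0 Real.pi,
        ENNReal.ofReal (p.1 ^ (k + 1) * Real.sin p.2 ^ k) * f p := by
  have hunit : ‖‖u‖⁻¹ • u‖ = 1 := norm_smul_inv_norm hu
  have hangle (y : V) : angle u y = angle (‖u‖⁻¹ • u) y :=
    (angle_smul_left_of_pos _ _ (inv_pos.2 (norm_pos_iff.2 hu))).symm
  let g : ℝ × ℝ → ℝ≥0∞ := fun q =>
    f (√(q.1 ^ 2 + q.2 ^ 2), Real.arccos (q.1 / √(q.1 ^ 2 + q.2 ^ 2)))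
  have hg : Measurable g := by fun_prop
  have hg_polar {p : ℝ × ℝ} (hp : p ∈ Ioi (0 : ℝ) ×ˢ Ioo 0 Real.pi) :
      g (p.1 * Real.cos p.2, p.1 * Real.sin p.2) = f p := by
    obtain ⟨hr, hθ⟩ : 0 < p.1 ∧ p.2 ∈ Ioo 0 Real.pi := hp
    have hsqrt : √((p.1 * Real.cos p.2) ^ 2 + (p.1 * Real.sin p.2) ^ 2) = p.1 := by
      rw [mul_pow, mul_pow, ← mul_add, Real.cos_sq_add_sin_sq, mul_one, Real.sqrt_sq hr.le]
    simp only [g, hsqrt]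
    rw [mul_div_cancel_left₀ _ hr.ne', Real.arccos_cos hθ.1.le hθ.2.le]
  rw [← (measurePreserving_smul_add_orthogonal hunit).lintegral_comp (by fun_prop)]
  simp only [hangle, norm_smul_add_of_mem_orthogonal hunit (Subtype.prop _),
    angle_smul_add_of_mem_orthogonal hunit (Subtype.prop _)]
  refine (lintegral_comp_cylindrical hV hunit hg).trans ?_
  rw [lintegral_halfPlane_eq_lintegral_polar]
  congr 1
  refine setLIntegral_congr_fun (measurableSet_Ioi.prod measurableSet_Ioo) fun p hp => ?_
  have hr : 0 < p.1 := hp.1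
  dsimp only
  rw [hg_polar hp, ← mul_assoc, ← ENNReal.ofReal_mul hr.le]
  congr 2
  ring

theorem lintegral_comp_norm_norm_angle (hV : finrank ℝ V = k + 2) {f : ℝ × ℝ × ℝ → ℝ≥0∞}
    (hf : Measurable f) :
    ∫⁻ p : V × V, f (‖p.1‖, ‖p.2‖, angle p.1 p.2) =
      sphereArea (k + 2) * sphereArea (k + 1) *
        ∫⁻ t in Ioi (0 : ℝ) ×ˢ Ioi (0 : ℝ) ×ˢ Ioo 0 Real.pi,
          ENNReal.ofReal ((t.1 * t.2.1) ^ (k + 1) * Real.sin t.2.2 ^ k) * f t := by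
  have : Nontrivial V := nontrivial_of_finrank_pos (R := ℝ) (by omega)
  let h : ℝ → ℝ≥0∞ := fun r => ∫⁻ p in Ioi (0 : ℝ) ×ˢ Ioo 0 Real.pi,
    ENNReal.ofReal (p.1 ^ (k + 1) * Real.sin p.2 ^ k) * f (r, p)
  have hh : Measurable h := by fun_prop
  have hfiber : ∀ᵐ x : V, ∫⁻ y : V, f (‖x‖, ‖y‖, angle x y) = sphereArea (k + 1) * h ‖x‖ := by
    filter_upwards [compl_mem_ae_iff.2 (measure_singleton (0 : V))] with x hx
    exact lintegral_comp_norm_angle hV hx (f := fun p => f (‖x‖, p)) (by fun_prop)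
  rw [Measure.volume_eq_prod, lintegral_prod _ (by fun_prop), lintegral_congr_ae hfiber,
    lintegral_const_mul _ (by fun_prop), lintegral_comp_norm hV hh, ← mul_assoc,
    mul_comm (sphereArea _), Measure.volume_eq_prod ℝ (ℝ × ℝ), ← Measure.prod_restrict,
    lintegral_prod _ (by fun_prop)]
  congr 1
  refine setLIntegral_congr_fun measurableSet_Ioi fun r hr => ?_
  rw [← lintegral_const_mul _ (by fun_prop)]
  congr 1 with p
  rw [mul_pow, mul_assoc, ENNReal.ofReal_mul (pow_nonneg (mem_Ioi.1 hr).le _), mul_assoc]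

theorem map_norm_norm_angle_volume (hV : finrank ℝ V = k + 2) :
    (volume : Measure (V × V)).map (fun p => (‖p.1‖, ‖p.2‖, angle p.1 p.2)) =
      (sphereArea (k + 2) * sphereArea (k + 1)) •
        (volume.restrict (Ioi 0 ×ˢ Ioi 0 ×ˢ Ioo 0 Real.pi)).withDensity
          fun t : ℝ × ℝ × ℝ => ENNReal.ofReal ((t.1 * t.2.1) ^ (k + 1) * Real.sin t.2.2 ^ k) := by
  refine Measure.ext_of_lintegral _ fun f hf => ?_
  rw [lintegral_map hf (by fun_prop), lintegral_comp_norm_norm_angle hV hf, lintegral_smul_measure,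
    lintegral_withDensity_eq_lintegral_mul _ (by fun_prop) hf]
  rfl

end SphericalCoordinates

section Chord

variable {r₁ r₂ : ℝ}

@[fun_prop]
theorem measurable_chord : Measurable fun t : ℝ × ℝ × ℝ => chord t.1 t.2.1 t.2.2 := by
  unfold chord
  fun_prop

theorem continuous_chord : Continuous (chord r₁ r₂) := by
  unfold chord
  fun_prop

theorem chord_zero (h₁ : 0 < r₁) (h₂ : 0 < r₂) : chord r₁ r₂ 0 = r₁ + r₂ := by
  rw [chord, Real.cos_zero, mul_one, add_right_comm, ← add_sq, Real.sqrt_sq (by positivity)]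

theorem chord_pi (r₁ r₂ : ℝ) : chord r₁ r₂ Real.pi = |r₁ - r₂| := by
  rw [chord, Real.cos_pi, ← Real.sqrt_sq_eq_abs]
  congr 1
  ring

theorem strictAntiOn_chord (h₁ : 0 < r₁) (h₂ : 0 < r₂) :
    StrictAntiOn (chord r₁ r₂) (Icc 0 Real.pi) := by
  intro θ hθ η hη h
  have hcos := Real.strictAntiOn_cos hθ hη h
  refine Real.sqrt_lt_sqrt ?_ (by gcongr)
  nlinarith [sq_nonneg (r₁ - r₂), Real.neg_one_le_cos η, mul_pos h₁ h₂]

theorem image_chord (h₁ : 0 < r₁) (h₂ : 0 < r₂) :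
    chord r₁ r₂ '' Ioo 0 Real.pi = Ioo |r₁ - r₂| (r₁ + r₂) := by
  rw [← chord_pi, ← chord_zero h₁ h₂]
  exact (strictAntiOn_chord h₁ h₂).mapsTo_Ioo.image_subset.antisymm
    (intermediate_value_Ioo' Real.pi_pos.le continuous_chord.continuousOn)

theorem chord_pos (h₁ : 0 < r₁) (h₂ : 0 < r₂) {θ : ℝ} (hθ : θ ∈ Ioo 0 Real.pi) :
    0 < chord r₁ r₂ θ :=
  (abs_nonneg _).trans_lt ((image_chord h₁ h₂).subset (mem_image_of_mem _ hθ)).1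

theorem hasDerivAt_chord {θ : ℝ} (hθ : 0 < chord r₁ r₂ θ) :
    HasDerivAt (chord r₁ r₂) (-(r₁ * r₂ * Real.sin θ / chord r₁ r₂ θ)) θ := by
  have hsqrt := (((Real.hasDerivAt_cos θ).const_mul (2 * r₁ * r₂)).const_add
    (r₁ ^ 2 + r₂ ^ 2)).sqrt (Real.sqrt_pos.1 hθ).ne'
  refine hsqrt.congr_deriv ?_
  rw [← chord]
  field_simp

theorem lintegral_comp_chord (h₁ : 0 < r₁) (h₂ : 0 < r₂) (f : ℝ → ℝ≥0∞) :
    ∫⁻ θ in Ioo 0 Real.pi, ENNReal.ofReal (r₁ * r₂ * Real.sin θ / chord r₁ r₂ θ) *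
      f (chord r₁ r₂ θ) = ∫⁻ z in Ioo |r₁ - r₂| (r₁ + r₂), f z := by
  have hderiv (θ : ℝ) (hθ : θ ∈ Ioo 0 Real.pi) :=
    (hasDerivAt_chord (chord_pos h₁ h₂ hθ)).hasDerivWithinAt (s := Ioo 0 Real.pi)
  rw [← image_chord h₁ h₂, lintegral_image_eq_lintegral_abs_deriv_mul measurableSet_Ioo hderiv
    ((strictAntiOn_chord h₁ h₂).injOn.mono Ioo_subset_Icc_self)]
  refine setLIntegral_congr_fun measurableSet_Ioo fun θ hθ => ?_
  have := Real.sin_pos_of_mem_Ioo hθ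
  have := chord_pos h₁ h₂ hθ
  rw [abs_neg, abs_of_nonneg (by positivity)]

theorem map_half_add_half_sub_volume :
    (volume : Measure (ℝ × ℝ)).map (fun p => ((p.1 + p.2) / 2, (p.1 - p.2) / 2)) =
      (2 : ℝ≥0∞) • volume := by
  let L := Matrix.toLin (Module.Basis.finTwoProd ℝ) (Module.Basis.finTwoProd ℝ)
    !![2⁻¹, 2⁻¹; 2⁻¹, -2⁻¹]
  have hL : ⇑L = fun p : ℝ × ℝ => ((p.1 + p.2) / 2, (p.1 - p.2) / 2) := by
    ext p <;> rw [Matrix.toLin_finTwoProd_apply] <;> ring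
  have hdet : LinearMap.det L = -2⁻¹ := by
    rw [LinearMap.det_toLin, Matrix.det_fin_two_of]
    norm_num
  rw [← hL, Measure.map_linearMap_addHaar_eq_smul_addHaar _ (by simp [hdet]), hdet]
  norm_num

theorem lintegral_prod_prod {X Y Z : Type*} [MeasureSpace X] [MeasureSpace Y] [MeasureSpace Z]
    [SFinite (volume : Measure Y)] [SFinite (volume : Measure Z)]
    {f : X × Y × Z → ℝ≥0∞} (hf : Measurable f) :
    ∫⁻ t, f t = ∫⁻ p : X × Y, ∫⁻ z, f (p.1, p.2, z) := by
  rw [← volume_preserving_prodAssoc.lintegral_comp hf]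
  exact lintegral_prod _ (by fun_prop)

theorem measurableSet_triangleRegion :
    MeasurableSet {t : ℝ × ℝ × ℝ | 0 < t.2.2 ∧ t.2.2 / 2 < t.1 ∧ |t.2.1| < t.2.2 / 2} := by
  measurability

theorem half_add_half_sub_mem_triangleRegion {z : ℝ} :
    ((r₁ + r₂) / 2, (r₁ - r₂) / 2, z) ∈
        {t : ℝ × ℝ × ℝ | 0 < t.2.2 ∧ t.2.2 / 2 < t.1 ∧ |t.2.1| < t.2.2 / 2} ↔
      (0 < r₁ ∧ 0 < r₂) ∧ z ∈ Ioo |r₁ - r₂| (r₁ + r₂) := by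
  simp only [mem_ofPred_eq, mem_Ioo, abs_lt]
  grind

theorem lintegral_comp_half_add_half_sub_chord {f : ℝ × ℝ × ℝ → ℝ≥0∞} (hf : Measurable f) :
    ∫⁻ t in Ioi (0 : ℝ) ×ˢ Ioi (0 : ℝ) ×ˢ Ioo 0 Real.pi,
        ENNReal.ofReal (t.1 * t.2.1 * Real.sin t.2.2 / chord t.1 t.2.1 t.2.2) *
          f ((t.1 + t.2.1) / 2, (t.1 - t.2.1) / 2, chord t.1 t.2.1 t.2.2) =
      2 * ∫⁻ t in {t | 0 < t.2.2 ∧ t.2.2 / 2 < t.1 ∧ |t.2.1| < t.2.2 / 2}, f t := by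
  have hS := measurableSet_triangleRegion
  have hf' := hf.indicator hS
  have hR : MeasurableSet (Ioi (0 : ℝ) ×ˢ Ioi (0 : ℝ) ×ˢ Ioo 0 Real.pi) := by measurability
  rw [← lintegral_indicator hS, lintegral_prod_prod hf', ← smul_eq_mul, ← lintegral_smul_measure,
    ← map_half_add_half_sub_volume, lintegral_map (by fun_prop) (by fun_prop),
    ← lintegral_indicator hR, lintegral_prod_prod (Measurable.indicator (by fun_prop) hR)]
  refine lintegral_congr fun p => ?_
  simp only [indicator, half_add_half_sub_mem_triangleRegion, mem_prod, mem_Ioi]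
  simp only [← and_assoc]
  by_cases hp : 0 < p.1 ∧ 0 < p.2
  · simpa only [hp, and_self, true_and, ← lintegral_indicator measurableSet_Ioo, indicator] using
      lintegral_comp_chord hp.1 hp.2 fun z => f ((p.1 + p.2) / 2, (p.1 - p.2) / 2, z)
  · simp only [hp, false_and, if_false]

theorem map_half_add_half_sub_chord_volume :
    ((volume.restrict (Ioi 0 ×ˢ Ioi 0 ×ˢ Ioo 0 Real.pi)).withDensity fun t =>
        ENNReal.ofReal (t.1 * t.2.1 * Real.sin t.2.2 / chord t.1 t.2.1 t.2.2)).map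
        (fun t => ((t.1 + t.2.1) / 2, (t.1 - t.2.1) / 2, chord t.1 t.2.1 t.2.2)) =
      (2 : ℝ≥0∞) • volume.restrict
        {t | 0 < t.2.2 ∧ t.2.2 / 2 < t.1 ∧ |t.2.1| < t.2.2 / 2} := by
  refine Measure.ext_of_lintegral _ fun f hf => ?_
  rw [lintegral_map hf (by fun_prop), lintegral_withDensity_eq_lintegral_mul _ (by fun_prop)
    (by fun_prop), lintegral_smul_measure]
  exact lintegral_comp_half_add_half_sub_chord hf

end Chord

section WithDensity

variable {X Y : Type*} [MeasurableSpace X] [MeasurableSpace Y]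

theorem map_withDensity_comp {ν : Measure X} {T : X → Y} (hT : Measurable T) {f : Y → ℝ≥0∞}
    (hf : Measurable f) : (ν.withDensity fun x => f (T x)).map T = (ν.map T).withDensity f := by
  refine Measure.ext_of_lintegral _ fun g hg => ?_
  rw [lintegral_map hg hT, lintegral_withDensity_eq_lintegral_mul _ hf hg,
    lintegral_map (hf.mul hg) hT,
    lintegral_withDensity_eq_lintegral_mul _ (f := fun x => f (T x)) (hf.comp hT)
      (g := fun x => g (T x)) (hg.comp hT)]
  rfl

theorem map_withDensity_eq_self {ν : Measure X} {T : X → X} (hT : MeasurePreserving T ν ν)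
    {f : X → ℝ≥0∞} (hf : Measurable f) (hfT : ∀ x, f (T x) = f x) :
    (ν.withDensity f).map T = ν.withDensity f := by
  simpa only [hfT, hT.map_eq] using map_withDensity_comp (ν := ν) hT.measurable hf

theorem closureLaw_withDensity {V : Type*} [MeasurableSpace V] [Neg V] [MeasurableNeg V]
    {ν : Measure X} {f : X → ℝ≥0∞} (hf : Measurable f) {h : V → ℝ≥0∞} (hh : Measurable h)
    {S : X → V} (hS : Measurable S) :
    closureLaw (ν.withDensity f) h S =
      ν.withDensity fun x => f x * (h (-S x) / ∫⁻ x, h (-S x) ∂ν.withDensity f) := by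
  have hhS : Measurable fun x => h (-S x) := hh.comp hS.neg
  rw [closureLaw, ← withDensity_mul _ hf hhS, ← withDensity_smul _ (hf.mul hhS)]
  congr 1 with x
  simp only [Pi.smul_apply, Pi.mul_apply, smul_eq_mul, ENNReal.div_eq_inv_mul]
  ring

end WithDensity

section PairDensity

theorem varianceGammaPDF_three_two_one {r : ℝ} (hr : 0 < r) :
    varianceGammaPDF 3 2 1 r =
      ENNReal.ofReal (Real.exp (-(r / 2)) / (16 * Real.pi * r)) := by
  have hpi := Real.pi_pos
  rw [varianceGammaPDF_of_pos two_pos one_pos hr]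
  have hpow : (4 * Real.pi * 2 ^ 2) ^ (((3 : ℕ) : ℝ) / 2) =
      16 * Real.pi * (4 * Real.sqrt Real.pi) := by
    rw [show 4 * Real.pi * 2 ^ 2 = 16 * Real.pi by ring,
      show ((3 : ℕ) : ℝ) / 2 = 1 + 1 / 2 by norm_num,
      Real.rpow_add (by positivity), Real.rpow_one, ← Real.sqrt_eq_rpow,
      show 16 * Real.pi = 4 ^ 2 * Real.pi by norm_num, Real.sqrt_mul (by positivity),
      Real.sqrt_sq (by norm_num)]
  have hpow' : (r / 2 / 2) ^ (-(1 / 2) : ℝ) = 2 / Real.sqrt r := by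
    rw [Real.rpow_neg (by positivity), ← Real.sqrt_eq_rpow, div_div, Real.sqrt_div hr.le,
      show (2 : ℝ) * 2 = 2 ^ 2 by norm_num, Real.sqrt_sq two_pos.le, inv_div]
  rw [hpow, show (1 : ℝ) - ((3 : ℕ) : ℝ) / 2 = -(1 / 2) by norm_num, hpow', besselK_neg,
    besselK_half, Real.Gamma_one, mul_div_cancel₀ r two_ne_zero, Real.sqrt_div hpi.le]
  congr 1
  field_simp
  rw [Real.sq_sqrt hr.le]
  ring

theorem varianceGammaPDF_div_varianceGammaPDF_add_two_zero {α z : ℝ} (hα : 0 < α) (hz : 0 < z) :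
    varianceGammaPDF 3 2 α z / varianceGammaPDF 3 2 (α + 2) 0 =
      ENNReal.ofReal (8 * (Real.Gamma (α + 2) / (Real.sqrt Real.pi * Real.Gamma (2 * α))) *
        z ^ (α - 3 / 2) * besselK (α - 3 / 2) (z / 2)) := by
  have : 0 < Real.Gamma α := Real.Gamma_pos_of_pos hα
  have : 0 < Real.Gamma (α + 1 / 2) := Real.Gamma_pos_of_pos (by linarith)
  have : 0 < Real.Gamma (α + 2) := Real.Gamma_pos_of_pos (by linarith)
  have : 0 < (4 : ℝ) ^ (α - 3 / 2) := by positivity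
  have hdup : Real.sqrt Real.pi * Real.Gamma (2 * α) =
      4 * 4 ^ (α - 3 / 2) * (Real.Gamma α * Real.Gamma (α + 1 / 2)) := by
    have hpow_two : (4 : ℝ) ^ (α - 3 / 2) * 2 ^ (1 - 2 * α) = 1 / 4 := by
      rw [show (4 : ℝ) = 2 ^ (2 : ℝ) by norm_num, ← Real.rpow_mul two_pos.le,
        ← Real.rpow_add two_pos, show 2 * (α - 3 / 2) + (1 - 2 * α) = -2 by ring]
      norm_num
    rw [Real.Gamma_mul_Gamma_add_half]
    linear_combination (-4 * Real.Gamma (2 * α) * Real.sqrt Real.pi) * hpow_two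
  have := Real.pi_pos
  have hhalf : α + 2 - (3 : ℕ) / 2 = α + 1 / 2 := by
    push_cast
    ring
  rw [varianceGammaPDF_of_pos two_pos hα hz, varianceGammaPDF_zero two_pos (by linarith), hhalf,
    ← ENNReal.ofReal_div_of_pos (by positivity), hdup, div_div, Real.div_rpow hz.le (by norm_num),
    Nat.cast_ofNat, show (2 : ℝ) * 2 = 4 by norm_num]
  congr 1
  field_simp
  ring

/-- The density of a pair of edges of a closed `(M + 2)`-gon, as a function of the two lengths and
of the angle: the `M` other edges sum to a vector whose length is the chord. -/
def edgePairPDF (M : ℕ) (t : ℝ × ℝ × ℝ) : ℝ≥0∞ :=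
  varianceGammaPDF 3 2 1 t.1 * varianceGammaPDF 3 2 1 t.2.1 *
    (varianceGammaPDF 3 2 M (chord t.1 t.2.1 t.2.2) / varianceGammaPDF 3 2 (M + 2) 0)

variable {M : ℕ}

theorem measurable_edgePairPDF (hM : 0 < M) : Measurable (edgePairPDF M) := by
  have hM' : (0 : ℝ) < M := mod_cast hM
  have := (continuous_varianceGammaPDF (d := 3) two_pos one_pos).measurable
  have := (continuous_varianceGammaPDF (d := 3) two_pos hM').measurable
  unfold edgePairPDF
  fun_prop

theorem IsHopfGaussianPolygonMeasure.map_pair_eq_withDensity (hM : 0 < M) {i j : Fin (M + 2)}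
    (hij : i ≠ j) {μ : Measure (closedPolygons (M + 2))}
    (hμ : IsHopfGaussianPolygonMeasure (M + 2) μ) :
    μ.map (fun p => (p.1 i, p.1 j)) = volume.withDensity fun p : E3 × E3 =>
      edgePairPDF M (‖p.1‖, ‖p.2‖, InnerProductGeometry.angle p.1 p.2) := by
  have hadd : Measurable fun p : E3 × E3 => p.1 + p.2 := by fun_prop
  have hmeas (α : ℝ) := measurable_varianceGammaPDF_norm (V := E3) 2 α
  have hZ := lintegral_varianceGammaPDF_neg_of_map_eq two_pos (sub_finrank_E3_pos one_lt_two)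
    (β := M) (mod_cast hM) hadd map_add_prod_hopfLaw
  have hprod : hopfLaw.prod hopfLaw = volume.withDensity fun p : E3 × E3 =>
      varianceGammaPDF (Module.finrank ℝ E3) 2 1 ‖p.1‖ *
        varianceGammaPDF (Module.finrank ℝ E3) 2 1 ‖p.2‖ := by
    rw [hopfLaw_eq_varianceGamma, varianceGamma, prod_withDensity (hmeas 1) (hmeas 1),
      Measure.volume_eq_prod]
  have hmeas_mul : Measurable fun p : E3 × E3 => varianceGammaPDF (Module.finrank ℝ E3) 2 1 ‖p.1‖ *
      varianceGammaPDF (Module.finrank ℝ E3) 2 1 ‖p.2‖ :=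
    ((hmeas 1).comp measurable_fst).mul ((hmeas 1).comp measurable_snd)
  rw [hμ.map_pair_eq_closureLaw hM hij, hprod, closureLaw_withDensity hmeas_mul (hmeas M) hadd,
    ← hprod, hZ]
  simp only [edgePairPDF, finrank_euclideanSpace_fin, norm_neg, norm_add_eq_chord, add_comm (M : ℝ),
    Nat.cast_ofNat]

theorem ofReal_mul_edgePairPDF (hM : 0 < M) {r₁ r₂ θ : ℝ} (h₁ : 0 < r₁) (h₂ : 0 < r₂)
    (hθ : θ ∈ Ioo 0 Real.pi) :
    sphereArea 3 * sphereArea 2 * (ENNReal.ofReal ((r₁ * r₂) ^ 2 * Real.sin θ) *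
      edgePairPDF M (r₁, r₂, θ)) = ENNReal.ofReal (pairDensity (M + 2) r₁ r₂ θ) := by
  have hM' : (0 : ℝ) < M := mod_cast hM
  have hz := chord_pos h₁ h₂ hθ
  have hsin := Real.sin_pos_of_mem_Ioo hθ
  have := Real.pi_pos
  have : 0 < Real.Gamma (2 * (M : ℝ)) := Real.Gamma_pos_of_pos (by positivity)
  rw [edgePairPDF, varianceGammaPDF_three_two_one h₁, varianceGammaPDF_three_two_one h₂,
    varianceGammaPDF_div_varianceGammaPDF_add_two_zero hM' hz, sphereArea_three, sphereArea_two]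
  iterate 5 rw [← ENNReal.ofReal_mul (by positivity)]
  congr 1
  rw [pairDensity, show -(1 / 2) * (r₁ + r₂) = -(r₁ / 2) + -(r₂ / 2) by ring, Real.exp_add,
    show 2 * ((M + 2 : ℕ) : ℝ) - 4 = 2 * M by push_cast; ring,
    show ((M + 2 : ℕ) : ℝ) - 7 / 2 = M - 3 / 2 by push_cast; ring, Nat.cast_add, Nat.cast_ofNat]
  field_simp
  ring

theorem pairDensity_eq_mul_pairDensityXYZ (n : ℕ) {r₁ r₂ θ : ℝ} (hz : 0 < chord r₁ r₂ θ) :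
    pairDensity n r₁ r₂ θ = r₁ * r₂ * Real.sin θ / chord r₁ r₂ θ *
      (2⁻¹ * pairDensityXYZ n ((r₁ + r₂) / 2) ((r₁ - r₂) / 2) (chord r₁ r₂ θ)) := by
  simp only [pairDensity, pairDensityXYZ]
  rw [show (n : ℝ) - 5 / 2 = (n - 7 / 2) + 1 by ring, Real.rpow_add_one hz.ne',
    show -(1 / 2) * (r₁ + r₂) = -((r₁ + r₂) / 2) by ring]
  generalize besselK ((n : ℝ) - 7 / 2) (chord r₁ r₂ θ / 2) = K
  field_simp
  norm_num

theorem map_norm_norm_angle_withDensity_edgePairPDF (hM : 0 < M) :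
    ((volume : Measure (E3 × E3)).withDensity fun p =>
        edgePairPDF M (‖p.1‖, ‖p.2‖, InnerProductGeometry.angle p.1 p.2)).map
        (fun p => (‖p.1‖, ‖p.2‖, InnerProductGeometry.angle p.1 p.2)) =
      (volume.restrict (Ioi 0 ×ˢ Ioi 0 ×ˢ Ioo 0 Real.pi)).withDensity
        fun t => ENNReal.ofReal (pairDensity (M + 2) t.1 t.2.1 t.2.2) := by
  have hF := measurable_edgePairPDF hM
  have hR : MeasurableSet (Ioi (0 : ℝ) ×ˢ Ioi (0 : ℝ) ×ˢ Ioo 0 Real.pi) := by measurability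
  rw [map_withDensity_comp (by fun_prop) hF, map_norm_norm_angle_volume (k := 1) (by simp),
    withDensity_smul_measure, ← withDensity_mul _ (by fun_prop) hF,
    ← withDensity_smul _ (.mul (by fun_prop) hF)]
  refine withDensity_congr_ae ((ae_restrict_iff' hR).2 (ae_of_all _ fun t ht => ?_))
  simpa using ofReal_mul_edgePairPDF hM ht.1 ht.2.1 ht.2.2

theorem measurable_pairDensityXYZ (n : ℕ) :
    Measurable fun t : ℝ × ℝ × ℝ => pairDensityXYZ n t.1 t.2.1 t.2.2 := by
  have := measurable_besselK ((n : ℝ) - 7 / 2)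
  unfold pairDensityXYZ
  fun_prop

theorem withDensity_pairDensity (n : ℕ) :
    (volume.restrict (Ioi 0 ×ˢ Ioi 0 ×ˢ Ioo 0 Real.pi)).withDensity
        (fun t => ENNReal.ofReal (pairDensity n t.1 t.2.1 t.2.2)) =
      ((volume.restrict (Ioi 0 ×ˢ Ioi 0 ×ˢ Ioo 0 Real.pi)).withDensity fun t =>
        ENNReal.ofReal (t.1 * t.2.1 * Real.sin t.2.2 / chord t.1 t.2.1 t.2.2)).withDensity
        fun t => 2⁻¹ * ENNReal.ofReal (pairDensityXYZ n ((t.1 + t.2.1) / 2)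
          ((t.1 - t.2.1) / 2) (chord t.1 t.2.1 t.2.2)) := by
  have hR : MeasurableSet (Ioi (0 : ℝ) ×ˢ Ioi (0 : ℝ) ×ˢ Ioo 0 Real.pi) := by measurability
  have hΦ : Measurable fun t : ℝ × ℝ × ℝ =>
      ((t.1 + t.2.1) / 2, (t.1 - t.2.1) / 2, chord t.1 t.2.1 t.2.2) := by fun_prop
  have hF := ((measurable_pairDensityXYZ n).ennreal_ofReal.const_mul 2⁻¹).comp hΦ
  refine Eq.trans ?_ (withDensity_mul _ (by fun_prop) hF)
  refine withDensity_congr_ae ((ae_restrict_iff' hR).2 (ae_of_all _ fun t ht => ?_))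
  have h₁ : 0 < t.1 := ht.1
  have h₂ : 0 < t.2.1 := ht.2.1
  have hz := chord_pos h₁ h₂ ht.2.2
  have := Real.sin_pos_of_mem_Ioo ht.2.2
  simp only [Pi.mul_apply]
  rw [pairDensity_eq_mul_pairDensityXYZ n hz, ENNReal.ofReal_mul (by positivity),
    ENNReal.ofReal_mul (by positivity), ENNReal.ofReal_inv_of_pos two_pos, ENNReal.ofReal_ofNat]

theorem map_half_add_half_sub_chord_withDensity_pairDensity (n : ℕ) :
    ((volume.restrict (Ioi 0 ×ˢ Ioi 0 ×ˢ Ioo 0 Real.pi)).withDensity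
        fun t => ENNReal.ofReal (pairDensity n t.1 t.2.1 t.2.2)).map
        (fun t => ((t.1 + t.2.1) / 2, (t.1 - t.2.1) / 2, chord t.1 t.2.1 t.2.2)) =
      (volume.restrict {t | 0 < t.2.2 ∧ t.2.2 / 2 < t.1 ∧ |t.2.1| < t.2.2 / 2}).withDensity
        fun t => ENNReal.ofReal (pairDensityXYZ n t.1 t.2.1 t.2.2) := by
  have hF := (measurable_pairDensityXYZ n).ennreal_ofReal.const_mul 2⁻¹
  rw [withDensity_pairDensity, map_withDensity_comp (by fun_prop) hF,
    map_half_add_half_sub_chord_volume, withDensity_smul_measure, ← withDensity_smul _ hF]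
  congr 1 with t
  exact ENNReal.mul_inv_cancel_left two_ne_zero ENNReal.ofNat_ne_top

end PairDensity

section Rotation

/-- A rotation as a linear isometry of `ℝ³`. -/
def rotLinearIsometryEquiv (A : SO3) : E3 ≃ₗᵢ[ℝ] E3 :=
  Unitary.linearIsometryEquiv
    ⟨Matrix.toEuclideanCLM (𝕜 := ℝ) A.1,
      Unitary.map_mem Matrix.toEuclideanCLM (Matrix.mem_specialOrthogonalGroup_iff.1 A.2).1⟩

theorem norm_rot (A : SO3) (v : E3) : ‖rot A v‖ = ‖v‖ :=
  (rotLinearIsometryEquiv A).norm_map v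

theorem angle_rot (A : SO3) (v w : E3) :
    InnerProductGeometry.angle (rot A v) (rot A w) = InnerProductGeometry.angle v w :=
  (rotLinearIsometryEquiv A).toLinearIsometry.angle_map v w

theorem measurePreserving_rot (A : SO3) : MeasurePreserving (rot A) :=
  (rotLinearIsometryEquiv A).measurePreserving

variable {F : ℝ × ℝ × ℝ → ℝ≥0∞}

theorem map_rot_rot_withDensity (hF : Measurable F) (A : SO3) :
    ((volume : Measure (E3 × E3)).withDensity fun p =>
        F (‖p.1‖, ‖p.2‖, InnerProductGeometry.angle p.1 p.2)).map
        (fun p => (rot A p.1, rot A p.2)) =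
      volume.withDensity fun p => F (‖p.1‖, ‖p.2‖, InnerProductGeometry.angle p.1 p.2) := by
  refine map_withDensity_eq_self ((measurePreserving_rot A).prod (measurePreserving_rot A))
    (by fun_prop) fun p => ?_
  simp only [Prod.map, norm_rot, angle_rot]

variable {R : E3 → SO3}

theorem angle_rot_right_of_rot_eq_self {A : SO3} {v : E3} (hA : rot A v = v) (w : E3) :
    InnerProductGeometry.angle v (rot A w) = InnerProductGeometry.angle v w := by
  simpa only [hA] using angle_rot A v w

theorem measurePreserving_rot_right (hRm : Measurable fun p : E3 × E3 => rot (R p.1) p.2) :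
    MeasurePreserving fun p : E3 × E3 => (p.1, rot (R p.1) p.2) :=
  (MeasurePreserving.id volume).skew_product (g := fun v w => rot (R v) w) hRm
    (Eventually.of_forall fun v => (measurePreserving_rot (R v)).map_eq)

theorem measurePreserving_rot_left (hRm : Measurable fun p : E3 × E3 => rot (R p.1) p.2) :
    MeasurePreserving fun p : E3 × E3 => (rot (R p.2) p.1, p.2) :=
  Measure.measurePreserving_swap.comp
    ((measurePreserving_rot_right hRm).comp Measure.measurePreserving_swap)

theorem map_rot_right_withDensity (hF : Measurable F) (hR : ∀ v, rot (R v) v = v)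
    (hRm : Measurable fun p : E3 × E3 => rot (R p.1) p.2) :
    ((volume : Measure (E3 × E3)).withDensity fun p =>
        F (‖p.1‖, ‖p.2‖, InnerProductGeometry.angle p.1 p.2)).map
        (fun p => (p.1, rot (R p.1) p.2)) =
      volume.withDensity fun p => F (‖p.1‖, ‖p.2‖, InnerProductGeometry.angle p.1 p.2) := by
  refine map_withDensity_eq_self (measurePreserving_rot_right hRm) (by fun_prop) fun p => ?_
  simp only [norm_rot, angle_rot_right_of_rot_eq_self (hR p.1)]

theorem map_rot_left_withDensity (hF : Measurable F) (hR : ∀ v, rot (R v) v = v)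
    (hRm : Measurable fun p : E3 × E3 => rot (R p.1) p.2) :
    ((volume : Measure (E3 × E3)).withDensity fun p =>
        F (‖p.1‖, ‖p.2‖, InnerProductGeometry.angle p.1 p.2)).map
        (fun p => (rot (R p.2) p.1, p.2)) =
      volume.withDensity fun p => F (‖p.1‖, ‖p.2‖, InnerProductGeometry.angle p.1 p.2) := by
  refine map_withDensity_eq_self (measurePreserving_rot_left hRm) (by fun_prop) fun p => ?_
  simp only [norm_rot, InnerProductGeometry.angle_comm _ p.2,
    angle_rot_right_of_rot_eq_self (hR p.2)]

end Rotation

/-- The joint law of the edges `eᵢ` and `eⱼ`, consecutive or not, of a closed polygon with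
law `μ`. -/
def twoEdgeLaw {n : ℕ} (μ : Measure (closedPolygons n)) (i j : Fin n) : Measure (E3 × E3) :=
  μ.map fun p => (p.1 i, p.1 j)

theorem ne_finRotate {n : ℕ} (hn : 2 ≤ n) (i : Fin n) : i ≠ finRotate n i := by
  obtain ⟨m, rfl⟩ := Nat.exists_eq_add_of_le' hn
  simp [finRotate_apply]

theorem proposition9_general (n : ℕ) (hn : 2 < n) :
    (∃! μ : Measure (closedPolygons n), IsHopfGaussianPolygonMeasure n μ) ∧
    ∀ μ : Measure (closedPolygons n), IsHopfGaussianPolygonMeasure n μ →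
      ∀ i j : Fin n, i ≠ j →
      (∀ A : SO3, (twoEdgeLaw μ i j).map (fun p => (rot A p.1, rot A p.2)) =
        twoEdgeLaw μ i j) ∧
      (∀ R : E3 → SO3, (∀ v, rot (R v) v = v) → Measurable (fun p : E3 × E3 => rot (R p.1) p.2) →
        (twoEdgeLaw μ i j).map (fun p => (p.1, rot (R p.1) p.2)) = twoEdgeLaw μ i j ∧
        (twoEdgeLaw μ i j).map (fun p => (rot (R p.2) p.1, p.2)) = twoEdgeLaw μ i j) ∧
      (∃ F : ℝ × ℝ × ℝ → ℝ≥0∞, Measurable F ∧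
        twoEdgeLaw μ i j = (volume : Measure (E3 × E3)).withDensity
          (fun p => F (‖p.1‖, ‖p.2‖, InnerProductGeometry.angle p.1 p.2))) ∧
      (twoEdgeLaw μ i j).map
          (fun p => (‖p.1‖, ‖p.2‖, InnerProductGeometry.angle p.1 p.2)) =
        ((volume : Measure (ℝ × ℝ × ℝ)).restrict
          (Ioi 0 ×ˢ Ioi 0 ×ˢ Ioo 0 Real.pi)).withDensity
          (fun t => ENNReal.ofReal (pairDensity n t.1 t.2.1 t.2.2)) ∧
      (twoEdgeLaw μ i j).map
          (fun p => ((‖p.1‖ + ‖p.2‖) / 2, (‖p.1‖ - ‖p.2‖) / 2, ‖p.1 + p.2‖)) =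
        ((volume : Measure (ℝ × ℝ × ℝ)).restrict
          {t | 0 < t.2.2 ∧ t.2.2 / 2 < t.1 ∧ |t.2.1| < t.2.2 / 2}).withDensity
          (fun t => ENNReal.ofReal (pairDensityXYZ n t.1 t.2.1 t.2.2)) := by
  refine ⟨existsUnique_isHopfGaussianPolygonMeasure hn, fun μ hμ i j hij => ?_⟩
  obtain ⟨M, rfl⟩ : ∃ M, n = M + 2 := Nat.exists_eq_add_of_le' hn.le
  have hM : 0 < M := by omega
  have hF := measurable_edgePairPDF hM
  have h_pair := hμ.map_pair_eq_withDensity hM hij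
  have h_angle := map_norm_norm_angle_withDensity_edgePairPDF hM
  rw [twoEdgeLaw, h_pair]
  refine ⟨map_rot_rot_withDensity hF, fun R hR hRm =>
    ⟨map_rot_right_withDensity hF hR hRm, map_rot_left_withDensity hF hR hRm⟩,
    ⟨edgePairPDF M, hF, rfl⟩, h_angle, ?_⟩
  rw [← map_half_add_half_sub_chord_withDensity_pairDensity, ← h_angle,
    Measure.map_map (by fun_prop) (by fun_prop)]
  simp only [Function.comp_def, norm_add_eq_chord]

end HopfPolygon

end

open HopfPolygon in
theorem proposition9 (n : ℕ) (hn : 3 < n) :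
    -- the Hopf-Gaussian measure on closed polygons exists and is unique
    (∃! μ : Measure (closedPolygons n), IsHopfGaussianPolygonMeasure n μ) ∧
    ∀ μ : Measure (closedPolygons n), IsHopfGaussianPolygonMeasure n μ → ∀ i : Fin n,
      -- invariance under the diagonal action of the rotation group
      (∀ A : SO3, (edgePairLaw μ i).map (fun p => (rot A p.1, rot A p.2)) = edgePairLaw μ i) ∧
      -- invariance under rotations that fix the first edge, or the second edge
      (∀ R : E3 → SO3, (∀ v, rot (R v) v = v) → Measurable (fun p : E3 × E3 => rot (R p.1) p.2) →
        (edgePairLaw μ i).map (fun p => (p.1, rot (R p.1) p.2)) = edgePairLaw μ i ∧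
        (edgePairLaw μ i).map (fun p => (rot (R p.2) p.1, p.2)) = edgePairLaw μ i) ∧
      -- the joint density depends only on the two lengths and the angle
      (∃ F : ℝ × ℝ × ℝ → ℝ≥0∞, Measurable F ∧
        edgePairLaw μ i = (volume : Measure (E3 × E3)).withDensity
          (fun p => F (‖p.1‖, ‖p.2‖, InnerProductGeometry.angle p.1 p.2))) ∧
      -- the density in the variables `r₁, r₂, θ`
      (edgePairLaw μ i).map
          (fun p => (‖p.1‖, ‖p.2‖, InnerProductGeometry.angle p.1 p.2)) =
        ((volume : Measure (ℝ × ℝ × ℝ)).restrict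
          (Set.Ioi 0 ×ˢ Set.Ioi 0 ×ˢ Set.Ioo 0 Real.pi)).withDensity
          (fun t => ENNReal.ofReal (pairDensity n t.1 t.2.1 t.2.2)) ∧
      -- the density in the variables `x = (r₁ + r₂) / 2`, `y = (r₁ - r₂) / 2`, `z = ‖e₁ + e₂‖`
      (edgePairLaw μ i).map
          (fun p => ((‖p.1‖ + ‖p.2‖) / 2, (‖p.1‖ - ‖p.2‖) / 2, ‖p.1 + p.2‖)) =
        ((volume : Measure (ℝ × ℝ × ℝ)).restrict
          {t | 0 < t.2.2 ∧ t.2.2 / 2 < t.1 ∧ |t.2.1| < t.2.2 / 2}).withDensity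
          (fun t => ENNReal.ofReal (pairDensityXYZ n t.1 t.2.1 t.2.2)) := by
  obtain ⟨h_exists, h_law⟩ := proposition9_general n (by omega)
  exact ⟨h_exists, fun μ hμ i => h_law μ hμ i _ (ne_finRotate (by omega) i)⟩
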